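/- Logarithms are natural. Let $\mathcal X,\mathcal Y_1,\mathcal Y_2,\mathcal Z$ be finite, $|\mathcal X|\ge 2$, $x_0\in\mathcal X$, and let $P_{Y_1|X},P_{Y_2|X},P_{Z|X}$ be channels from $\mathcal X$ to $\mathcal Y_1,\mathcal Y_2,\mathcal Z$ (a broadcast channel with a warden). Put $Q_0=P_{Z|X}(\cdot|x_0)$. Assume: (a) $Q_0$ is not in the convex hull of $\{P_{Z|X}(\cdot|x'):x'\ne x_0\}$; (b) $P_{Z|X}(\cdot|x)\ll Q_0$ for all $x$; (c) $P_{Y_k|X}(\cdot|x)\ll P_{Y_k|X}(\cdot|x_0)$ for all $x$ and $k=1,2$; (d) the channel is stochastically degraded: $P_{Y_2|X}(y_2|x)=\sum_{y_1}P_{Y_1|X}(y_1|x)V(y_2|y_1)$ for some channel $V$. For $\delta>0$ and $n\ge 1$ let $\mathcal L^{(I)}_{n,\delta}$ be the set of nonnegative pairs $(L_1,L_2)$ for which there are a finite set $\mathcal U$ and a pmf $P_{UX}$ on $\mathcal U\times\mathcal X$ such that, under $P_{UX}P_{Y_k|X}$ and with $P_Z$ the warden's output distribution induced by $P_X$, $$L_1\le\sqrt{n/\delta}\,I(X;Y_1|U),\qquad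 L_2\le\sqrt{n/\delta}\,I(U;Y_2),\qquad D(P_Z\|Q_0)\le\delta/n .$$ Let $\mathcal L^{(I)}_\delta$ be the limit of these regions as $n\to\infty$, that is, the set of limits of convergent sequences $(p_n)$ with $p_n\in\mathcal L^{(I)}_{n,\delta}$ for all $n\ge1$. Let $\chi_2(P\|Q)=\sum_z (P(z)-Q(z))^2/Q(z)$ (the sum being over the support of $Q$, and $P\ll Q$), and let $\tilde{\mathcal L}^{(I)}$ be the set of nonnegative pairs $(L_1,L_2)$ such that $$L_1\le\sqrt{\tfrac{2}{\chi_2(\nu)}}\Big[(1-\nu)\sum_x\tilde P^A_X(x)\,D\big(P_{Y_1|X}(\cdot|x)\,\|\,P_{Y_1|X}(\cdot|x_0)\big)+\nu\, I^B(Y_1;X|U)\Big],$$ $$L_2\le\sqrt{\tfrac{2}{\chi_2(\nu)}}\Big[\nu\sum_xP^B_X(x)\,D\big(P_{Y_2|X}(\cdot|x)\,\|\,P_{Y_2|X}(\cdot|x_0)\big)-\nu\, I^B(Y_2;X|U)\Big]$$ for some $\nu\in[0,1]$, some alphabet $\mathcal U$ with $|\mathcal U|\le|\mathcal X|+1$,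 a singleton $A=\{u_0\}\subset\mathcal U$ with complement $B=\mathcal U\setminus A$, a pmf $P^B_{UX}$ on $B\times\mathcal X$ and a pmf $\tilde P^A_X$ on $\mathcal X\setminus\{x_0\}$, with $$\chi_2(\nu)=\chi_2\big((1-\nu)\tilde P^A_Z+\nu P^B_Z\,\big\|\,Q_0\big)>0 .$$ Here $P_X^B$ is the $X$-marginal of $P_{UX}^B$, $I^B$ is computed under $P^B_{UX}P_{Y_k|X}$, and $\tilde P^A_Z,P^B_Z$ are the output distributions of $P_{Z|X}$ for the inputs $\tilde P^A_X,P^B_X$. Then, for every $\delta>0$, $$\mathcal L^{(I)}_\delta=\tilde{\mathcal L}^{(I)} .$$ Moreover the limit exists in the full sense: the outer limit $\bigcap_{N\ge1}\overline{\bigcup_{n\ge N}\mathcal L^{(I)}_{n,\delta}}$ is also equal to $\tilde{\mathcal L}^{(I)}$. Further, $\bigcap_{n\ge1}\mathcal L^{(I)}_{n,\delta}\subseteq\tilde{\mathcal L}^{(I)}$, with equality if the regions $\mathcal L^{(I)}_{n,\delta}$ are nonincreasing in $n$. -/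

import Mathlib

open Filter Topology

/-! Information measures for finite alphabets, in nats. A pmf on a finite set `α` is an element of
`stdSimplex ℝ α`. -/

namespace CovertInfo

/-- Divergence `D(p‖q)` of pmfs on a finite alphabet. It is used only for `p` absolutely continuous
with respect to `q`. -/
noncomputable def divergence {α : Type*} [Fintype α] (p q : α → ℝ) : ℝ :=
  ∑ a, p a * Real.log (p a / q a)

/-- The `χ₂`-distance `∑ (p - q)² / q`. It is used only for `p` absolutely continuous with respect
to `q`; letters outside the support of `q` then contribute zero. -/
noncomputable def chiSq {α : Type*} [Fintype α] (p q : α → ℝ) : ℝ :=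
  ∑ a, (p a - q a) ^ 2 / q a

/-- Mutual information of a joint pmf `p a b`. -/
noncomputable def mutualInfo {α β : Type*} [Fintype α] [Fintype β] (p : α → β → ℝ) : ℝ :=
  ∑ a, ∑ b, p a b * Real.log (p a b / ((∑ b', p a b') * (∑ a', p a' b)))

/-- Conditional mutual information `I(α; β | γ)` of a joint pmf `p c a b`. -/
noncomputable def condMutualInfo {γ α β : Type*} [Fintype γ] [Fintype α] [Fintype β]
    (p : γ → α → β → ℝ) : ℝ :=
  ∑ c, ∑ a, ∑ b, p c a b *
    Real.log (p c a b * (∑ a', ∑ b', p c a' b') / ((∑ b', p c a b') * (∑ a', p c a' b)))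

/-- The output distribution `P_X ∘ W` of the channel `W` for the input distribution `p`. -/
noncomputable def output {α β : Type*} [Fintype α] (p : α → ℝ) (W : α → β → ℝ) : β → ℝ :=
  fun b => ∑ a, p a * W a b

/-- The `X`-marginal of a joint distribution on `U × X`. -/
noncomputable def marginalX {υ α : Type*} [Fintype υ] (P : υ × α → ℝ) : α → ℝ :=
  fun x => ∑ u, P (u, x)

/-- `I(U; Y)` under `P_{UX} W_{Y|X}`. -/
noncomputable def infoUY {υ α β : Type*} [Fintype υ] [Fintype α] [Fintype β]
    (P : υ × α → ℝ) (W : α → β → ℝ) : ℝ :=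
  mutualInfo fun (u : υ) (y : β) => ∑ x, P (u, x) * W x y

/-- `I(X; Y | U)` under `P_{UX} W_{Y|X}`. -/
noncomputable def infoXYgivenU {υ α β : Type*} [Fintype υ] [Fintype α] [Fintype β]
    (P : υ × α → ℝ) (W : α → β → ℝ) : ℝ :=
  condMutualInfo fun (u : υ) (x : α) (y : β) => P (u, x) * W x y

end CovertInfo

/-- A two-user discrete memoryless broadcast channel with a warden and zero symbol `x₀`, given by
the conditional marginals `W₁ = P_{Y₁|X}`, `W₂ = P_{Y₂|X}`, `WZ = P_{Z|X}`. -/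
structure CovertBC (X Y₁ Y₂ Z : Type*) [Fintype Y₁] [Fintype Y₂] [Fintype Z] where
  W₁ : X → Y₁ → ℝ
  W₂ : X → Y₂ → ℝ
  WZ : X → Z → ℝ
  x₀ : X
  W₁_mem : ∀ x, W₁ x ∈ stdSimplex ℝ Y₁
  W₂_mem : ∀ x, W₂ x ∈ stdSimplex ℝ Y₂
  WZ_mem : ∀ x, WZ x ∈ stdSimplex ℝ Z

namespace CovertBC

open CovertInfo

variable {X Y₁ Y₂ Z : Type*} [Fintype X] [Fintype Y₁] [Fintype Y₂] [Fintype Z]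

/-- The zero symbol is not redundant at the warden: `Q₀` is not in the convex hull of the output
distributions of the other symbols. -/
def NonRedundant (C : CovertBC X Y₁ Y₂ Z) : Prop :=
  C.WZ C.x₀ ∉ convexHull ℝ {q : Z → ℝ | ∃ x, x ≠ C.x₀ ∧ q = C.WZ x}

/-- At each of the three outputs, every output distribution is absolutely continuous with respect to
the one of the zero symbol. -/
def AbsCont (C : CovertBC X Y₁ Y₂ Z) : Prop :=
  (∀ x z, C.WZ C.x₀ z = 0 → C.WZ x z = 0) ∧
  (∀ x y, C.W₁ C.x₀ y = 0 → C.W₁ x y = 0) ∧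
  (∀ x y, C.W₂ C.x₀ y = 0 → C.W₂ x y = 0)

/-- User 2 is stochastically degraded with respect to user 1. -/
def Degraded (C : CovertBC X Y₁ Y₂ Z) : Prop :=
  ∃ V : Y₁ → Y₂ → ℝ, (∀ y₁, V y₁ ∈ stdSimplex ℝ Y₂) ∧
    ∀ x y₂, C.W₂ x y₂ = ∑ y₁, C.W₁ x y₁ * V y₁ y₂

/-- The region at blocklength `n`. The auxiliary alphabet is an arbitrary finite set. -/
def regionAt (C : CovertBC X Y₁ Y₂ Z) (δ : ℝ) (n : ℕ) : Set (ℝ × ℝ) :=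
  {L | 0 ≤ L.1 ∧ 0 ≤ L.2 ∧ ∃ (m : ℕ) (P : Fin m × X → ℝ), P ∈ stdSimplex ℝ (Fin m × X) ∧
    divergence (output (marginalX P) C.WZ) (C.WZ C.x₀) ≤ δ / n ∧
    L.1 ≤ √(n / δ) * infoXYgivenU P C.W₁ ∧
    L.2 ≤ √(n / δ) * infoUY P C.W₂}

/-- The (inner) limit of the regions as `n → ∞`: all limits of sequences of pairs, the `n`-th pair
being in the `n`-th region. -/
def limitRegion (C : CovertBC X Y₁ Y₂ Z) (δ : ℝ) : Set (ℝ × ℝ) :=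
  {L | ∃ p : ℕ → ℝ × ℝ, (∀ n, 1 ≤ n → p n ∈ C.regionAt δ n) ∧ Tendsto p atTop (𝓝 L)}

/-- The outer limit of the regions as `n → ∞`: all cluster points of such sequences. -/
def outerLimitRegion (C : CovertBC X Y₁ Y₂ Z) (δ : ℝ) : Set (ℝ × ℝ) :=
  ⋂ (N : ℕ) (_ : 1 ≤ N), closure (⋃ (n : ℕ) (_ : N ≤ n), C.regionAt δ n)

/-- The single-letter region. The auxiliary alphabet is `Fin k`, `A = {u₀}`, `B` is the complement
of `A`, and the distribution `PA` on `X \ {x₀}` is given as a distribution on `X` without mass at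
`x₀`. -/
noncomputable def singleLetterRegion (C : CovertBC X Y₁ Y₂ Z) : Set (ℝ × ℝ) :=
  {L | 0 ≤ L.1 ∧ 0 ≤ L.2 ∧
    ∃ (ν : ℝ) (k : ℕ) (u₀ : Fin k) (PB : {u : Fin k // u ≠ u₀} × X → ℝ) (PA : X → ℝ),
      ν ∈ Set.Icc (0 : ℝ) 1 ∧ k ≤ Fintype.card X + 1 ∧
      PB ∈ stdSimplex ℝ ({u : Fin k // u ≠ u₀} × X) ∧
      PA ∈ stdSimplex ℝ X ∧ PA C.x₀ = 0 ∧
      ∃ χ : ℝ, χ = chiSq (fun z => (1 - ν) * output PA C.WZ z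
          + ν * output (marginalX PB) C.WZ z) (C.WZ C.x₀) ∧ 0 < χ ∧
        L.1 ≤ √(2 / χ) * ((1 - ν) * (∑ x, PA x * divergence (C.W₁ x) (C.W₁ C.x₀))
          + ν * infoXYgivenU PB C.W₁) ∧
        L.2 ≤ √(2 / χ) * (ν * (∑ x, marginalX PB x * divergence (C.W₂ x) (C.W₂ C.x₀))
          - ν * infoXYgivenU PB C.W₂)}

end CovertBC

/-! All quantities are read off one convex set. To an input pmf p attach its information point: p,
the mutual information I(X;Y₁), and D(P_{Y₂}‖P_{Y₂|X}(·|x₀)). A joint law P_{UX} averages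
information points, so `infoHull` describes all auxiliary alphabets at once (`mem_regionAt_iff`);
I(U;Y₂) is the third coordinate minus the divergence at Y₂ of the averaged input.

Write p as mass 1-μ at x₀ and mass μ along a direction q without mass at x₀. Its information point
lies on the segment from the base point of x₀ to a rate point, at parameter μ (`infoPoint_mix`);
rate points extend continuously to μ = 0. Hence every point of `infoHull` is a mass μ times a point
v of the compact convex set `rateHull`.

The covertness divergence is μ²χ₂/2 + O(μ³), with χ₂ bounded away from zero by nonredundancy and
compactness. The constraint δ/n therefore allows √(n/δ)·μ up to √(2/χ₂) asymptotically, and the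
divergence subtracted in I(U;Y₂) is O(μ²), which vanishes after scaling. So inner and outer limits
both equal `rateRegion` (`outerLimitRegion_subset`, `rateRegion_subset_limitRegion`).

This agrees with the single-letter region because rates are linear and χ₂ quadratic in the mass, so
that the normalized rates ignore any shift towards x₀. Rate points with μ = 0 merge into the letter
of A, those with μ > 0 become letters of B, and a conic Carathéodory argument bounds their number by
|X|. -/

namespace CovertInfo

/-! ### Homogeneous divergences and the mutual informations expressed by them. -/

variable {α β υ : Type*} [Fintype α]

lemma output_add (p q : α → ℝ) (W : α → β → ℝ) : output (p + q) W = output p W + output q W := by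
  funext y; simp [output, add_mul, Finset.sum_add_distrib]

lemma output_smul (c : ℝ) (p : α → ℝ) (W : α → β → ℝ) : output (c • p) W = c • output p W := by
  funext y; simp [output, Finset.mul_sum, mul_assoc]

lemma output_sum {ι : Type*} (s : Finset ι) (f : ι → α → ℝ) (W : α → β → ℝ) :
    output (∑ i ∈ s, f i) W = ∑ i ∈ s, output (f i) W := by
  funext y
  simp only [output, Finset.sum_apply, Finset.sum_mul]
  exact Finset.sum_comm

lemma output_single [DecidableEq α] (x : α) (W : α → β → ℝ) :
    output (Pi.single x 1) W = W x := by
  funext y; simp [output, Pi.single_apply]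

lemma continuous_output (W : α → β → ℝ) (y : β) : Continuous fun p : α → ℝ => output p W y := by
  unfold output; fun_prop

variable [Fintype β] [Fintype υ]

/-- The divergence of the output distribution of `p` from `W x₀`, extended to all vectors `p` so
that it is continuous and homogeneous. -/
noncomputable def outDiv (W : α → β → ℝ) (x₀ : α) (p : α → ℝ) : ℝ :=
  ∑ y, output p W y * Real.log (output p W y) - ∑ y, output p W y * Real.log (W x₀ y)
    - (∑ x, p x) * Real.log (∑ x, p x)

/-- The average over `p` of the divergences of the channel output distributions from `W x₀`. -/
noncomputable def avgDiv (W : α → β → ℝ) (x₀ : α) (p : α → ℝ) : ℝ :=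
  ∑ x, p x * divergence (W x) (W x₀)

/-- `W` is a channel whose output distributions are absolutely continuous with respect to the one
of `x₀`. -/
structure Dominated (W : α → β → ℝ) (x₀ : α) : Prop where
  mem : ∀ x, W x ∈ stdSimplex ℝ β
  ac : ∀ x y, W x₀ y = 0 → W x y = 0

lemma continuous_outDiv (W : α → β → ℝ) (x₀ : α) : Continuous (outDiv W x₀) := by
  unfold outDiv
  have h := continuous_output W
  refine (Continuous.sub (continuous_finsetSum _ fun y _ => ?_)
    (continuous_finsetSum _ fun y _ => ?_)).sub ?_
  · exact Real.continuous_mul_log.comp (h y)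
  · exact (h y).mul continuous_const
  · exact Real.continuous_mul_log.comp (f := fun p : α → ℝ => ∑ x, p x) (by fun_prop)

lemma avgDiv_add (W : α → β → ℝ) (x₀ : α) (p q : α → ℝ) :
    avgDiv W x₀ (p + q) = avgDiv W x₀ p + avgDiv W x₀ q := by
  simp [avgDiv, add_mul, Finset.sum_add_distrib]

lemma avgDiv_smul (W : α → β → ℝ) (x₀ : α) (c : ℝ) (p : α → ℝ) :
    avgDiv W x₀ (c • p) = c * avgDiv W x₀ p := by
  simp [avgDiv, Finset.mul_sum, mul_assoc]

lemma continuous_avgDiv (W : α → β → ℝ) (x₀ : α) : Continuous (avgDiv W x₀) := by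
  unfold avgDiv; fun_prop

lemma mul_mul_log_mul (c x : ℝ) :
    c * x * Real.log (c * x) = c * (x * Real.log x) + x * (c * Real.log c) := by
  rcases eq_or_ne c 0 with rfl | hc
  · simp
  rcases eq_or_ne x 0 with rfl | hx
  · simp
  rw [Real.log_mul hc hx]; ring

lemma divergence_self (q : β → ℝ) : divergence q q = 0 := by
  refine Finset.sum_eq_zero fun y _ => ?_
  rcases eq_or_ne (q y) 0 with h0 | h0 <;> simp [h0]

namespace Dominated

variable {W : α → β → ℝ} {x₀ : α} (h : Dominated W x₀)
include h

lemma sum_output (p : α → ℝ) : ∑ y, output p W y = ∑ x, p x := by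
  simp only [output]
  rw [Finset.sum_comm]
  simp [← Finset.mul_sum, (h.mem _).2]

lemma output_eq_zero (p : α → ℝ) {y : β} (hy : W x₀ y = 0) : output p W y = 0 := by
  simp [output, h.ac _ _ hy]

lemma output_nonneg {p : α → ℝ} (hp : ∀ x, 0 ≤ p x) (y : β) : 0 ≤ output p W y :=
  Finset.sum_nonneg fun x _ => mul_nonneg (hp x) ((h.mem x).1 y)

lemma output_mem {p : α → ℝ} (hp : p ∈ stdSimplex ℝ α) : output p W ∈ stdSimplex ℝ β :=
  ⟨h.output_nonneg hp.1, by rw [h.sum_output, hp.2]⟩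

lemma outDiv_smul (c : ℝ) (p : α → ℝ) : outDiv W x₀ (c • p) = c * outDiv W x₀ p := by
  simp only [outDiv, output_smul, Pi.smul_apply, smul_eq_mul, ← Finset.mul_sum, mul_mul_log_mul,
    Finset.sum_add_distrib]
  simp only [← Finset.sum_mul, ← Finset.mul_sum, h.sum_output, mul_assoc]
  ring

lemma outDiv_eq_divergence {p : α → ℝ} (hp : ∑ x, p x = 1) :
    outDiv W x₀ p = divergence (output p W) (W x₀) := by
  simp only [outDiv, divergence, hp, Real.log_one, mul_zero, sub_zero, ← Finset.sum_sub_distrib]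
  refine Finset.sum_congr rfl fun y _ => ?_
  rcases eq_or_ne (output p W y) 0 with h0 | h0
  · simp [h0]
  have h1 : W x₀ y ≠ 0 := fun h1 => h0 (h.output_eq_zero p h1)
  rw [Real.log_div h0 h1]; ring

/-- Adding the zero sum of `W x₀ y - output p W y` makes each summand nonnegative and convex in p;
nonnegativity, convexity and the local expansion all start from this form. -/
lemma outDiv_eq_klFun {p : α → ℝ} (hp : ∑ x, p x = 1) :
    outDiv W x₀ p = ∑ y, W x₀ y * InformationTheory.klFun (output p W y / W x₀ y) := by
  rw [h.outDiv_eq_divergence hp]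
  have h2 : ∑ y, (W x₀ y - output p W y) = 0 := by
    rw [Finset.sum_sub_distrib, h.sum_output, hp, (h.mem x₀).2, sub_self]
  rw [← add_zero (divergence _ _), ← h2, divergence, ← Finset.sum_add_distrib]
  refine Finset.sum_congr rfl fun y _ => ?_
  rcases eq_or_ne (W x₀ y) 0 with h0 | h0
  · simp [h0, h.output_eq_zero p h0]
  rw [InformationTheory.klFun_apply]
  field_simp
  ring

lemma outDiv_single [DecidableEq α] (x : α) :
    outDiv W x₀ (Pi.single x 1) = divergence (W x) (W x₀) := by
  rw [h.outDiv_eq_divergence (by simp), output_single]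

lemma outDiv_nonneg {p : α → ℝ} (hp : p ∈ stdSimplex ℝ α) : 0 ≤ outDiv W x₀ p := by
  rw [h.outDiv_eq_klFun hp.2]
  exact Finset.sum_nonneg fun y _ => mul_nonneg ((h.mem x₀).1 y) (InformationTheory.klFun_nonneg
    (div_nonneg (h.output_nonneg hp.1 y) ((h.mem x₀).1 y)))

lemma convexOn_outDiv : ConvexOn ℝ (stdSimplex ℝ α) (outDiv W x₀) := by
  refine ⟨convex_stdSimplex ℝ α, fun p hp q hq a b ha hb hab => ?_⟩
  have hpq := convex_stdSimplex ℝ α hp hq ha hb hab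
  rw [h.outDiv_eq_klFun hp.2, h.outDiv_eq_klFun hq.2, h.outDiv_eq_klFun hpq.2, Finset.smul_sum,
    Finset.smul_sum, ← Finset.sum_add_distrib]
  refine Finset.sum_le_sum fun y _ => ?_
  have hw := (h.mem x₀).1 y
  have := InformationTheory.convexOn_klFun.2
    (x := output p W y / W x₀ y) (div_nonneg (h.output_nonneg hp.1 y) hw)
    (y := output q W y / W x₀ y) (div_nonneg (h.output_nonneg hq.1 y) hw) ha hb hab
  simp only [output_add, output_smul, Pi.add_apply, Pi.smul_apply, smul_eq_mul, add_div,
    mul_div_assoc] at this ⊢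
  nlinarith

lemma outDiv_le_avgDiv {p : α → ℝ} (hp : p ∈ stdSimplex ℝ α) : outDiv W x₀ p ≤ avgDiv W x₀ p := by
  classical
  have := h.convexOn_outDiv.map_sum_le (t := Finset.univ) (w := p)
    (p := fun x => Pi.single x (1 : ℝ)) (fun x _ => hp.1 x) hp.2
    (fun x _ => single_mem_stdSimplex ℝ x)
  rw [← pi_eq_sum_univ' p] at this
  simpa [h.outDiv_single, avgDiv] using this

lemma avgDiv_eq {p : α → ℝ} : avgDiv W x₀ p =
    ∑ x, ∑ y, p x * (W x y * (Real.log (W x y) - Real.log (W x₀ y))) := by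
  simp only [avgDiv, divergence, Finset.mul_sum]
  refine Finset.sum_congr rfl fun x _ => Finset.sum_congr rfl fun y _ => ?_
  rcases eq_or_ne (W x y) 0 with h0 | h0
  · simp [h0]
  rw [Real.log_div h0 fun h1 => h0 (h.ac x y h1)]

/-- For a pmf p, I(X;Y) is the average divergence from `W x₀` minus the divergence of the averaged
output. Homogeneity absorbs the weight of u, so the unnormalized slices can be used. -/
lemma infoXYgivenU_eq {P : υ × α → ℝ} (hP : ∀ i, 0 ≤ P i) :
    infoXYgivenU P W =
      ∑ u, (avgDiv W x₀ (fun x => P (u, x)) - outDiv W x₀ (fun x => P (u, x))) := by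
  simp only [infoXYgivenU, condMutualInfo]
  refine Finset.sum_congr rfl fun u _ => ?_
  set p : α → ℝ := fun x => P (u, x) with hp
  have hp0 : ∀ x, 0 ≤ p x := fun x => hP _
  have e1 : outDiv W x₀ p = ∑ x, ∑ y, p x * W x y *
      (Real.log (output p W y) - Real.log (W x₀ y) - Real.log (∑ x, p x)) := by
    rw [Finset.sum_comm]
    simp only [← Finset.sum_mul]
    simp only [outDiv, mul_sub, Finset.sum_sub_distrib, ← Finset.sum_mul]
    congr 2
    rw [← h.sum_output]; rfl
  rw [h.avgDiv_eq, e1, ← Finset.sum_sub_distrib]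
  refine Finset.sum_congr rfl fun x _ => ?_
  rw [← Finset.sum_sub_distrib]
  refine Finset.sum_congr rfl fun y _ => ?_
  change p x * W x y * Real.log (p x * W x y * (∑ a', ∑ b', p a' * W a' b') /
    ((∑ b', p x * W x b') * output p W y)) = _
  simp only [← Finset.mul_sum, (h.mem _).2, mul_one]
  rcases (hp0 x).eq_or_lt with h0 | h0
  · simp [← h0]
  rcases ((h.mem x).1 y).eq_or_lt with h1 | h1
  · simp [← h1]
  have h2 : 0 < output p W y := Finset.sum_pos' (fun x _ => mul_nonneg (hp0 x) ((h.mem x).1 y))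
    ⟨x, Finset.mem_univ _, mul_pos h0 h1⟩
  have h3 : 0 < ∑ x, p x := Finset.sum_pos' (fun x _ => hp0 x) ⟨x, Finset.mem_univ _, h0⟩
  rw [Real.log_div (by positivity) (by positivity), Real.log_mul (by positivity) (by positivity),
    Real.log_mul (by positivity) (by positivity), Real.log_mul (by positivity) (by positivity)]
  ring

lemma infoUY_eq {P : υ × α → ℝ} (hP : P ∈ stdSimplex ℝ (υ × α)) :
    infoUY P W = ∑ u, outDiv W x₀ (fun x => P (u, x)) - outDiv W x₀ (marginalX P) := by
  have hm : marginalX P = ∑ u, fun x => P (u, x) := by funext x; simp [marginalX]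
  have hs : ∑ x, marginalX P x = 1 := by
    rw [← hP.2, Fintype.sum_prod_type, Finset.sum_comm]; rfl
  have e : outDiv W x₀ (marginalX P) = ∑ u, ∑ y, output (fun x => P (u, x)) W y *
      (Real.log (output (marginalX P) W y) - Real.log (W x₀ y)) := by
    rw [Finset.sum_comm, outDiv, hs]
    simp only [← Finset.sum_mul, Real.log_one, mul_zero, sub_zero, mul_sub, Finset.sum_sub_distrib]
    simp only [hm, output_sum, Finset.sum_apply]
  rw [e, ← Finset.sum_sub_distrib]
  simp only [infoUY, mutualInfo]
  refine Finset.sum_congr rfl fun u _ => ?_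
  set p : α → ℝ := fun x => P (u, x) with hp
  have hp0 : ∀ x, 0 ≤ p x := fun x => hP.1 _
  have e1 : outDiv W x₀ p = ∑ y, output p W y *
      (Real.log (output p W y) - Real.log (W x₀ y) - Real.log (∑ x, p x)) := by
    simp only [outDiv, mul_sub, Finset.sum_sub_distrib, ← Finset.sum_mul, h.sum_output]
  rw [e1, ← Finset.sum_sub_distrib]
  refine Finset.sum_congr rfl fun y _ => ?_
  change output p W y * Real.log (output p W y / ((∑ b, output p W b) *
    (∑ a', output (fun x => P (a', x)) W y))) = _
  have hsum : ∑ a', output (fun x => P (a', x)) W y = output (marginalX P) W y := by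
    simp only [hm, output_sum, Finset.sum_apply]
  rw [hsum, h.sum_output]
  have hle : output p W y ≤ output (marginalX P) W y := by
    rw [← hsum]
    exact Finset.single_le_sum (f := fun a' => output (fun x => P (a', x)) W y)
      (fun a _ => h.output_nonneg (fun x => hP.1 _) y) (Finset.mem_univ u)
  rcases (h.output_nonneg hp0 y).eq_or_lt with h0 | h0
  · simp [← h0]
  have h2 : 0 < output (marginalX P) W y := h0.trans_le hle
  have h3 : 0 < ∑ x, p x := by
    rw [← h.sum_output]
    exact Finset.sum_pos' (fun y _ => h.output_nonneg hp0 y) ⟨y, Finset.mem_univ _, h0⟩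
  rw [Real.log_div (by positivity) (by positivity), Real.log_mul (by positivity) (by positivity)]
  ring

end Dominated

end CovertInfo

/-! ### Second-order expansion of the divergence near the zero symbol. -/

namespace CovertInfo
open InformationTheory

lemma klFun_le_sq {x : ℝ} (hx : 0 ≤ x) : klFun x ≤ (x - 1) ^ 2 := by
  rcases hx.eq_or_lt with rfl | hx
  · simp [klFun_zero]
  have := mul_le_mul_of_nonneg_left (Real.log_le_sub_one_of_pos hx) hx.le
  rw [klFun_apply]
  nlinarith

/-- With s = √x, the bound log s ≥ 1 - 1/s gives klFun x ≥ (s - 1)², a Hellinger bound; then (x -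
1)² = (s - 1)²(s + 1)² and (s + 1)² ≤ 2(x + 1). -/
lemma sq_div_le_klFun {x : ℝ} (hx : 0 ≤ x) : (x - 1) ^ 2 / (2 * (x + 1)) ≤ klFun x := by
  rcases hx.eq_or_lt with rfl | hx
  · norm_num [klFun_zero]
  have hs := Real.sqrt_pos.2 hx
  set s := √x with hsdef
  have hxs : x = s ^ 2 := (Real.sq_sqrt hx.le).symm
  have h1 := Real.one_sub_inv_le_log_of_pos hs
  have h2 : 2 * s ^ 2 - 2 * s ≤ x * Real.log x := by
    have : Real.log x = 2 * Real.log s := by rw [hxs, Real.log_pow]; norm_num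
    rw [this, hxs]
    have h3 : 2 * s ^ 2 - 2 * s = s ^ 2 * (2 * (1 - s⁻¹)) := by field_simp
    rw [h3]
    gcongr
  rw [klFun_apply, div_le_iff₀ (by positivity)]
  have h4 : (s - 1) ^ 2 ≤ x * Real.log x + 1 - x := by rw [hxs] at h2 ⊢; linarith
  have h5 : (x - 1) ^ 2 ≤ (s - 1) ^ 2 * (2 * (x + 1)) := by
    rw [hxs]
    nlinarith [mul_nonneg (sq_nonneg (s - 1)) (sq_nonneg (s - 1))]
  refine h5.trans ?_
  gcongr

lemma abs_klFun_sub_sq_le {t : ℝ} (ht : |t| ≤ 1 / 2) :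
    |klFun (1 + t) - t ^ 2 / 2| ≤ 4 * |t| ^ 3 := by
  have h := Real.abs_log_sub_add_sum_range_le (x := -t) (by rw [abs_neg]; linarith) 2
  simp only [Finset.sum_range_succ, Finset.sum_range_zero, abs_neg] at h
  norm_num at h
  have h2 : |t| ^ 3 / (1 - |t|) ≤ 2 * |t| ^ 3 := by
    rw [div_le_iff₀ (by linarith)]
    have := pow_nonneg (abs_nonneg t) 3
    nlinarith
  have h3 : |-t + t ^ 2 / 2 + Real.log (1 + t)| ≤ 2 * |t| ^ 3 := h.trans h2
  have e : klFun (1 + t) - t ^ 2 / 2 =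
      (1 + t) * (-t + t ^ 2 / 2 + Real.log (1 + t)) - t ^ 3 / 2 := by
    rw [klFun_apply]; ring
  have h4 : |1 + t| ≤ 3 / 2 := (abs_add_le _ _).trans (by rw [abs_one]; linarith)
  rw [e]
  refine (abs_sub _ _).trans ?_
  rw [abs_mul, abs_div, abs_pow, abs_two]
  have := mul_le_mul h4 h3 (abs_nonneg _) (by norm_num)
  have := pow_nonneg (abs_nonneg t) 3
  linarith

variable {α β : Type*}

/-- The distribution with mass `1 - μ` at `x₀` and with mass `μ` distributed according to `p`. -/
def mix [DecidableEq α] (x₀ : α) (μ : ℝ) (p : α → ℝ) : α → ℝ :=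
  (1 - μ) • Pi.single x₀ 1 + μ • p

lemma continuous_mix [DecidableEq α] (x₀ : α) :
    Continuous fun v : ℝ × (α → ℝ) => mix x₀ v.1 v.2 := by
  unfold mix; fun_prop

variable [Fintype α]

lemma mix_mem [DecidableEq α] (x₀ : α) {μ : ℝ} (h0 : 0 ≤ μ) (h1 : μ ≤ 1) {p : α → ℝ}
    (hp : p ∈ stdSimplex ℝ α) : mix x₀ μ p ∈ stdSimplex ℝ α :=
  convex_stdSimplex ℝ α (single_mem_stdSimplex ℝ x₀) hp (by linarith) h0 (by ring)

lemma output_mix [DecidableEq α] (W : α → β → ℝ) (x₀ : α) (μ : ℝ) (p : α → ℝ) (y : β) :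
    output (mix x₀ μ p) W y = (1 - μ) * W x₀ y + μ * output p W y := by
  simp [mix, output_add, output_smul, output_single]

lemma sum_mix [DecidableEq α] (x₀ : α) (μ : ℝ) {p : α → ℝ} (hp : ∑ x, p x = 1) : ∑ x, mix x₀ μ p x = 1 := by
  simp [mix, Finset.sum_add_distrib, ← Finset.mul_sum, hp]

variable [Fintype β]

lemma chiSq_mix [DecidableEq α] (W : α → β → ℝ) (x₀ : α) (μ : ℝ) (p : α → ℝ) : chiSq (output (mix x₀ μ p) W) (W x₀) =
    μ ^ 2 * chiSq (output p W) (W x₀) := by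
  simp only [chiSq, output_mix, Finset.mul_sum]
  refine Finset.sum_congr rfl fun y _ => ?_
  ring

lemma chiSq_nonneg {p q : β → ℝ} (hq : ∀ b, 0 ≤ q b) : 0 ≤ chiSq p q :=
  Finset.sum_nonneg fun b _ => div_nonneg (sq_nonneg _) (hq b)

lemma chiSq_eq_sum_mul_sq {p q : β → ℝ} : chiSq p q = ∑ b, q b * (p b / q b - 1) ^ 2 := by
  refine Finset.sum_congr rfl fun b _ => ?_
  rcases eq_or_ne (q b) 0 with h | h
  · simp [h]
  · field_simp

lemma continuous_chiSq_output (W : α → β → ℝ) (q : β → ℝ) :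
    Continuous fun p : α → ℝ => chiSq (output p W) q := by
  unfold chiSq
  have := continuous_output W
  fun_prop

namespace Dominated

variable {W : α → β → ℝ} {x₀ : α} (h : Dominated W x₀)
include h

lemma exists_ratio_bound :
    ∃ R, 1 ≤ R ∧ ∀ p ∈ stdSimplex ℝ α, ∀ y, |output p W y / W x₀ y - 1| ≤ R := by
  have hpos : ∀ y, 0 ≤ (W x₀ y)⁻¹ := fun y => inv_nonneg.2 ((h.mem x₀).1 y)
  refine ⟨1 + ∑ y, (W x₀ y)⁻¹, ?_, fun p hp y => ?_⟩
  · have := Finset.sum_nonneg (s := Finset.univ) fun y _ => hpos y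
    linarith
  have hm := h.output_mem hp
  have h1 : output p W y ≤ 1 :=
    hm.2 ▸ Finset.single_le_sum (fun y _ => hm.1 y) (Finset.mem_univ y)
  have h2 : output p W y / W x₀ y ≤ ∑ y, (W x₀ y)⁻¹ := by
    rw [div_eq_mul_inv]
    exact (mul_le_of_le_one_left (hpos y) h1).trans
      (Finset.single_le_sum (fun y _ => hpos y) (Finset.mem_univ y))
  have h3 : 0 ≤ output p W y / W x₀ y := div_nonneg (hm.1 y) ((h.mem x₀).1 y)
  rw [abs_le]
  constructor <;> linarith

lemma one_add_mul_nonneg {μ : ℝ} (h0 : 0 ≤ μ) (h1 : μ ≤ 1) {p : α → ℝ}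
    (hp : p ∈ stdSimplex ℝ α) (y : β) : 0 ≤ 1 + μ * (output p W y / W x₀ y - 1) := by
  have h3 : 0 ≤ output p W y / W x₀ y := div_nonneg (h.output_nonneg hp.1 y) ((h.mem x₀).1 y)
  nlinarith [mul_nonneg h0 h3]

variable [DecidableEq α]

lemma outDiv_mix (μ : ℝ) {p : α → ℝ} (hp : ∑ x, p x = 1) :
    outDiv W x₀ (mix x₀ μ p) =
      ∑ y, W x₀ y * klFun (1 + μ * (output p W y / W x₀ y - 1)) := by
  rw [h.outDiv_eq_klFun (sum_mix x₀ μ hp)]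
  refine Finset.sum_congr rfl fun y _ => ?_
  rcases eq_or_ne (W x₀ y) 0 with h0 | h0
  · simp [h0]
  rw [output_mix W x₀]
  congr 2
  field_simp
  ring

lemma outDiv_mix_le {μ : ℝ} (h0 : 0 ≤ μ) (h1 : μ ≤ 1) {p : α → ℝ} (hp : p ∈ stdSimplex ℝ α) :
    outDiv W x₀ (mix x₀ μ p) ≤ μ ^ 2 * chiSq (output p W) (W x₀) := by
  rw [h.outDiv_mix μ hp.2, chiSq_eq_sum_mul_sq, Finset.mul_sum]
  refine Finset.sum_le_sum fun y _ => ?_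
  have := mul_le_mul_of_nonneg_left (klFun_le_sq (h.one_add_mul_nonneg h0 h1 hp y))
    ((h.mem x₀).1 y)
  exact this.trans_eq (by ring)

/-- All bounds are uniform in p. The crude lower bound, valid for every μ in [0,1], forces μ to be
small under the covertness constraint; only then does the sharp expansion apply. -/
lemma exists_outDiv_mix_bounds :
    ∃ K, 0 < K ∧ (∀ p ∈ stdSimplex ℝ α, chiSq (output p W) (W x₀) ≤ K) ∧
      (∀ μ, 0 ≤ μ → μ ≤ 1 → ∀ p ∈ stdSimplex ℝ α,
        μ ^ 2 * chiSq (output p W) (W x₀) ≤ K * outDiv W x₀ (mix x₀ μ p)) ∧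
      ∀ μ, 0 ≤ μ → μ * K ≤ 1 → ∀ p ∈ stdSimplex ℝ α,
        |outDiv W x₀ (mix x₀ μ p) - μ ^ 2 * chiSq (output p W) (W x₀) / 2| ≤ K * μ ^ 3 := by
  obtain ⟨R, hR, hb⟩ := h.exists_ratio_bound
  -- The summands serve the cubic remainder, the bound on χ₂, and the denominator in
  -- `sq_div_le_klFun`.
  refine ⟨4 * R ^ 3 + R ^ 2 + 2 * (R + 2), by positivity, fun p hp => ?_,
    fun μ h0 h1 p hp => ?_, fun μ h0 h1 p hp => ?_⟩
  · rw [chiSq_eq_sum_mul_sq]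
    calc ∑ b, W x₀ b * (output p W b / W x₀ b - 1) ^ 2 ≤ ∑ b, W x₀ b * R ^ 2 := by
          refine Finset.sum_le_sum fun y _ => mul_le_mul_of_nonneg_left ?_ ((h.mem x₀).1 y)
          rw [← sq_abs]
          exact pow_le_pow_left₀ (abs_nonneg _) (hb p hp y) 2
      _ = R ^ 2 := by rw [← Finset.sum_mul, (h.mem x₀).2, one_mul]
      _ ≤ _ := by nlinarith [pow_pos (zero_lt_one.trans_le hR) 3]
  · rw [h.outDiv_mix μ hp.2, chiSq_eq_sum_mul_sq, Finset.mul_sum, Finset.mul_sum]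
    refine Finset.sum_le_sum fun y _ => ?_
    have hn := h.one_add_mul_nonneg h0 h1 hp y
    set r := output p W y / W x₀ y - 1
    have hr : |r| ≤ R := hb p hp y
    have h2 := sq_div_le_klFun hn
    have h3 : μ * r ≤ R := by nlinarith [le_abs_self r, abs_nonneg r]
    have hkl := klFun_nonneg hn
    rw [div_le_iff₀ (by linarith)] at h2
    have h4 : μ ^ 2 * r ^ 2 ≤ (4 * R ^ 3 + R ^ 2 + 2 * (R + 2)) * klFun (1 + μ * r) := by
      have h5 : klFun (1 + μ * r) * (2 * (1 + μ * r + 1)) ≤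
          (4 * R ^ 3 + R ^ 2 + 2 * (R + 2)) * klFun (1 + μ * r) := by
        rw [mul_comm]
        gcongr
        nlinarith [pow_pos (zero_lt_one.trans_le hR) 3]
      nlinarith
    nlinarith [mul_le_mul_of_nonneg_left h4 ((h.mem x₀).1 y)]
  · have h1' : μ * R ≤ 1 / 2 := by
      have : μ * (2 * R) ≤ μ * (4 * R ^ 3 + R ^ 2 + 2 * (R + 2)) := by
        gcongr
        nlinarith [pow_pos (zero_lt_one.trans_le hR) 3]
      linarith
    rw [h.outDiv_mix μ hp.2, chiSq_eq_sum_mul_sq, Finset.mul_sum, Finset.sum_div,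
      ← Finset.sum_sub_distrib]
    refine (Finset.abs_sum_le_sum_abs _ _).trans ?_
    calc _ ≤ ∑ y, W x₀ y * (4 * R ^ 3 * μ ^ 3) := by
          refine Finset.sum_le_sum fun y _ => ?_
          set r := output p W y / W x₀ y - 1
          have hr : |r| ≤ R := hb p hp y
          have h2 : |μ * r| ≤ μ * R := by rw [abs_mul, abs_of_nonneg h0]; gcongr
          have h3 := abs_klFun_sub_sq_le (h2.trans h1')
          have e : W x₀ y * klFun (1 + μ * r) - μ ^ 2 * (W x₀ y * r ^ 2) / 2 =
            W x₀ y * (klFun (1 + μ * r) - (μ * r) ^ 2 / 2) := by ring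
          rw [e, abs_mul, abs_of_nonneg ((h.mem x₀).1 y)]
          refine mul_le_mul_of_nonneg_left (h3.trans ?_) ((h.mem x₀).1 y)
          have := pow_le_pow_left₀ (abs_nonneg _) h2 3
          nlinarith
      _ = 4 * R ^ 3 * μ ^ 3 := by rw [← Finset.sum_mul, (h.mem x₀).2, one_mul]
      _ ≤ _ := by
          have : 0 ≤ μ ^ 3 := by positivity
          gcongr
          nlinarith

end Dominated

end CovertInfo

/-! ### Convex hulls of compact sets, a Carathéodory reduction, lower closures. -/

section ConvexGeometry

/-- The convex hull of a compact set in a finite-dimensional space is compact. -/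
lemma IsCompact.convexHull_of_finiteDimensional {E : Type*} [AddCommGroup E] [Module ℝ E]
    [TopologicalSpace E] [IsTopologicalAddGroup E] [ContinuousSMul ℝ E] [FiniteDimensional ℝ E]
    {s : Set E} (hs : IsCompact s) : IsCompact (convexHull ℝ s) := by
  rcases s.eq_empty_or_nonempty with rfl | ⟨x₀, hx₀⟩
  · simp
  set d := Module.finrank ℝ E + 1
  have key : convexHull ℝ s = (fun v : (Fin d → ℝ) × (Fin d → E) => ∑ i, v.1 i • v.2 i) ''
      (stdSimplex ℝ (Fin d) ×ˢ Set.univ.pi fun _ => s) := by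
    refine Set.Subset.antisymm (fun x hx => ?_) ?_
    · obtain ⟨ι, _, z, w, hz, hi, hw, hw1, rfl⟩ := eq_pos_convex_span_of_mem_convexHull hx
      have hc : Fintype.card ι ≤ Fintype.card (Fin d) := by
        rw [Fintype.card_fin]
        exact hi.card_le_finrank_succ.trans (Nat.succ_le_succ (Submodule.finrank_le _))
      obtain ⟨e⟩ := Function.Embedding.nonempty_of_card_le hc
      -- Carathéodory gives at most d points; the remaining slots carry weight 0 and the dummy point
      -- x₀.
      have h1 : ∀ i, i ∉ Set.range e → Function.extend e w 0 i = 0 := fun i hi =>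
        Function.extend_apply' _ _ _ hi
      refine ⟨(Function.extend e w 0, Function.extend e z fun _ => x₀),
        ⟨⟨fun i => ?_, ?_⟩, fun i _ => ?_⟩, ?_⟩
      · by_cases h : i ∈ Set.range e
        · obtain ⟨j, rfl⟩ := h
          simp only [e.injective.extend_apply]
          exact (hw j).le
        · exact (h1 i h).ge
      · rw [← hw1]
        exact (Fintype.sum_of_injective e e.injective _ _ h1
          fun i => (e.injective.extend_apply _ _ _).symm).symm
      · by_cases h : i ∈ Set.range e
        · obtain ⟨j, rfl⟩ := h
          simp only [e.injective.extend_apply]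
          exact hz ⟨j, rfl⟩
        · simp only [Function.extend_apply' _ _ _ h]
          exact hx₀
      · refine (Fintype.sum_of_injective e e.injective _ _ (fun i hi => ?_) fun i => ?_).symm
        · simp [h1 i hi]
        · simp [e.injective.extend_apply]
    · rintro _ ⟨⟨w, z⟩, ⟨hw, hz⟩, rfl⟩
      exact mem_convexHull_of_exists_fintype w z hw.1 hw.2 (fun i => hz i trivial) rfl
  rw [key]
  refine ((isCompact_stdSimplex ℝ _).prod (isCompact_univ_pi fun _ => hs)).image ?_
  fun_prop

/-- Conic Carathéodory theorem with an objective: a nonnegative combination of vectors in an affine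
hyperplane off the origin can be replaced by one with at most `finrank ℝ V` terms, without
decreasing the objective `s`. -/
lemma exists_nonneg_weights_card_support_le {ι V : Type*} [Fintype ι] [AddCommGroup V]
    [Module ℝ V] [FiniteDimensional ℝ V] (f : ι → V) (ℓ : V →ₗ[ℝ] ℝ) (hℓ : ∀ i, ℓ (f i) = 1)
    (s : ι → ℝ) (w : ι → ℝ) (hw : ∀ i, 0 ≤ w i) :
    ∃ w' : ι → ℝ, (∀ i, 0 ≤ w' i) ∧ Nat.card {i // w' i ≠ 0} ≤ Module.finrank ℝ V ∧
      ∑ i, w' i • f i = ∑ i, w i • f i ∧ ∑ i, w i * s i ≤ ∑ i, w' i * s i := by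
  classical
  induction hn : Nat.card {i // w i ≠ 0} using Nat.strong_induction_on generalizing w with
  | _ n ih =>
  by_cases hle : n ≤ Module.finrank ℝ V
  · exact ⟨w, hw, hn ▸ hle, rfl, le_rfl⟩
  have hdep : ¬ LinearIndependent ℝ fun i : {i // w i ≠ 0} => f i := fun hli =>
    hle (by rw [← hn, Nat.card_eq_fintype_card]; exact hli.fintype_card_le_finrank)
  obtain ⟨g, hg, j, hj⟩ := Fintype.not_linearIndependent_iff.1 hdep
  obtain ⟨c, hc0, hcf, ⟨j, hj⟩, hcs⟩ : ∃ c : ι → ℝ, (∀ i, w i = 0 → c i = 0) ∧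
      ∑ i, c i • f i = 0 ∧ (∃ j, c j ≠ 0) ∧ 0 ≤ ∑ i, c i * s i := by
    let c : ι → ℝ := Function.extend Subtype.val g 0
    have hin := Subtype.val_injective (p := fun i => w i ≠ 0)
    have h0 : ∀ i, w i = 0 → c i = 0 := fun i hi =>
      Function.extend_apply' _ _ _ (by rintro ⟨a, rfl⟩; exact a.2 hi)
    have hf : ∑ i, c i • f i = 0 := by
      rw [← hg]
      refine (Fintype.sum_of_injective Subtype.val hin _ _ (fun i hi => ?_) fun i => ?_).symm
      · rw [h0 i (by_contra fun h => hi ⟨⟨i, h⟩, rfl⟩), zero_smul]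
      · simp only [c, hin.extend_apply]
    have hne : c j ≠ 0 := by simpa only [c, hin.extend_apply] using hj
    -- A dependency can be negated, so its sign is chosen to keep the objective from decreasing.
    rcases le_total 0 (∑ i, c i * s i) with h | h
    · exact ⟨c, h0, hf, ⟨j, hne⟩, h⟩
    · refine ⟨-c, fun i hi => by simp [h0 i hi], by simp [hf], ⟨j, by simpa⟩, ?_⟩
      simpa using h
  -- The hyperplane condition forces the coefficients to sum to zero, so some are negative; moving
  -- along c by the least ratio θ kills a weight and keeps the others nonnegative.
  have hsum : ∑ i, c i = 0 := by
    have := congrArg ℓ hcf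
    simpa [hℓ] using this
  obtain ⟨i₁, hi₁⟩ : ∃ i, c i < 0 := by
    by_contra! h
    exact hj ((Finset.sum_eq_zero_iff_of_nonneg fun i _ => h i).1 hsum j (Finset.mem_univ _))
  obtain ⟨i₀, hi₀, hmin⟩ := (Finset.univ.filter fun i => c i < 0).exists_min_image
    (fun i => w i / -c i) ⟨i₁, by simpa⟩
  replace hi₀ : c i₀ < 0 := by simpa using hi₀
  set θ := w i₀ / -c i₀
  have hθ : 0 ≤ θ := div_nonneg (hw _) (by linarith)
  have hnn : ∀ i, 0 ≤ w i + θ * c i := fun i => by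
    rcases lt_or_ge (c i) 0 with h | h
    · have := hmin i (by simpa)
      rw [le_div_iff₀ (by linarith)] at this
      linarith
    · exact add_nonneg (hw i) (mul_nonneg hθ h)
  have hzero : w i₀ + θ * c i₀ = 0 := by
    have : c i₀ ≠ 0 := hi₀.ne
    simp only [θ]
    field_simp
    ring
  have hw₀ : w i₀ ≠ 0 := fun h => hi₀.ne (hc0 _ h)
  have hlt : Nat.card {i // w i + θ * c i ≠ 0} < n := by
    rw [← hn, Nat.card_eq_fintype_card, Nat.card_eq_fintype_card, Fintype.card_subtype,
      Fintype.card_subtype]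
    refine Finset.card_lt_card ((Finset.ssubset_iff_of_subset fun i hi => ?_).2 ⟨i₀, ?_, ?_⟩)
    · simp only [Finset.mem_filter, Finset.mem_univ, true_and] at hi ⊢
      exact fun h => hi (by rw [h, hc0 i h]; simp)
    · simpa
    · simpa using hzero
  obtain ⟨w', h1, h2, h3, h4⟩ := ih _ hlt (fun i => w i + θ * c i) hnn rfl
  refine ⟨w', h1, h2, ?_, le_trans ?_ h4⟩
  · simp only [h3, add_smul, Finset.sum_add_distrib, mul_smul, ← Finset.smul_sum, hcf, smul_zero,
      add_zero]
  · simp only [add_mul, Finset.sum_add_distrib, mul_assoc, ← Finset.mul_sum]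
    linarith [mul_nonneg hθ hcs]

open scoped Pointwise in
/-- The lower closure of a compact set is closed. -/
lemma IsCompact.isClosed_setOf_exists_le {E F : Type*} [TopologicalSpace E] [AddCommGroup F]
    [PartialOrder F] [IsOrderedAddMonoid F] [TopologicalSpace F] [IsTopologicalAddGroup F]
    [OrderClosedTopology F] {K : Set E} (hK : IsCompact K) {f : E → F} (hf : ContinuousOn f K) :
    IsClosed {L | ∃ v ∈ K, L ≤ f v} := by
  have e : {L | ∃ v ∈ K, L ≤ f v} = f '' K + Set.Iic 0 := by
    ext L
    simp only [Set.mem_ofPred_eq, Set.mem_add, Set.mem_image, Set.mem_Iic]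
    constructor
    · rintro ⟨v, hv, hL⟩
      exact ⟨f v, ⟨v, hv, rfl⟩, L - f v, by simpa, by simp⟩
    · rintro ⟨_, ⟨v, hv, rfl⟩, y, hy, rfl⟩
      exact ⟨v, hv, by simpa⟩
  rw [e]
  exact isClosed_Iic.add_left_of_isCompact (hK.image_of_continuousOn hf)

end ConvexGeometry

/-! ### Directions away from the zero symbol and divergence rates. -/

namespace CovertInfo

/-- A nonnegative vector is a multiple of a distribution. -/
lemma exists_eq_sum_smul {α : Type*} [Fintype α] [Nonempty α] {f : α → ℝ} (hf : ∀ x, 0 ≤ f x) :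
    ∃ q ∈ stdSimplex ℝ α, f = (∑ x, f x) • q := by
  classical
  rcases (Finset.sum_nonneg fun x (_ : x ∈ Finset.univ) => hf x).eq_or_lt with h | h
  · refine ⟨_, single_mem_stdSimplex ℝ (Classical.arbitrary α), ?_⟩
    rw [← h, zero_smul]
    funext x
    exact (Finset.sum_eq_zero_iff_of_nonneg fun x _ => hf x).1 h.symm x (Finset.mem_univ x)
  · refine ⟨(∑ x, f x)⁻¹ • f, ⟨fun x => mul_nonneg (by positivity) (hf x), ?_⟩, ?_⟩
    · simp only [Pi.smul_apply, smul_eq_mul, ← Finset.mul_sum]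
      exact inv_mul_cancel₀ h.ne'
    · rw [smul_smul, mul_inv_cancel₀ h.ne', one_smul]

variable {α β : Type*} [Fintype α] [Fintype β]

lemma avgDiv_single [DecidableEq α] (W : α → β → ℝ) (x₀ x : α) :
    avgDiv W x₀ (Pi.single x 1) = divergence (W x) (W x₀) := by
  simp [avgDiv, Pi.single_apply]

lemma avgDiv_mix [DecidableEq α] (W : α → β → ℝ) (x₀ : α) (μ : ℝ) (p : α → ℝ) :
    avgDiv W x₀ (mix x₀ μ p) = μ * avgDiv W x₀ p := by
  simp [mix, avgDiv_add, avgDiv_smul, avgDiv_single, divergence_self]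

/-- The distributions without mass at `x₀`. -/
def puncturedSimplex (x₀ : α) : Set (α → ℝ) := stdSimplex ℝ α ∩ {p | p x₀ = 0}

lemma convex_puncturedSimplex (x₀ : α) : Convex ℝ (puncturedSimplex x₀) := by
  refine (convex_stdSimplex ℝ α).inter fun p hp q hq a b _ _ _ => ?_
  simp_all

lemma isCompact_puncturedSimplex (x₀ : α) : IsCompact (puncturedSimplex x₀) :=
  (isCompact_stdSimplex ℝ α).inter_right (isClosed_eq (continuous_apply x₀) continuous_const)

lemma puncturedSimplex_nonempty [Nontrivial α] (x₀ : α) : (puncturedSimplex x₀).Nonempty := by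
  classical
  obtain ⟨x, hx⟩ := exists_ne x₀
  exact ⟨_, single_mem_stdSimplex ℝ x, by simp [hx.symm]⟩

lemma exists_eq_mix [DecidableEq α] [Nontrivial α] (x₀ : α) {p : α → ℝ}
    (hp : p ∈ stdSimplex ℝ α) :
    ∃ μ ∈ Set.Icc (0 : ℝ) 1, ∃ q ∈ puncturedSimplex x₀, p = mix x₀ μ q := by
  have hs : ∑ x, p x = p x₀ + ∑ x ∈ Finset.univ.erase x₀, p x :=
    (Finset.add_sum_erase _ _ (Finset.mem_univ x₀)).symm
  have hr : 0 ≤ ∑ x ∈ Finset.univ.erase x₀, p x := Finset.sum_nonneg fun x _ => hp.1 x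
  rw [hp.2] at hs
  have h1 : p x₀ ≤ 1 := by linarith
  rcases h1.eq_or_lt with h1 | h1
  · obtain ⟨q, hq⟩ := puncturedSimplex_nonempty x₀
    refine ⟨0, by simp, q, hq, ?_⟩
    have h0 : ∑ x ∈ Finset.univ.erase x₀, p x = 0 := by linarith
    rw [Finset.sum_eq_zero_iff_of_nonneg fun x _ => hp.1 x] at h0
    funext x
    rcases eq_or_ne x x₀ with rfl | hx
    · simp [mix, h1]
    · simp [mix, hx, h0 x (by simp [hx])]
  · have h2 : 0 < 1 - p x₀ := by linarith
    refine ⟨1 - p x₀, ⟨h2.le, by linarith [hp.1 x₀]⟩,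
      (1 - p x₀)⁻¹ • Function.update p x₀ 0, ⟨⟨fun x => ?_, ?_⟩, by simp⟩, ?_⟩
    · refine mul_nonneg (by positivity) ?_
      rcases eq_or_ne x x₀ with rfl | hx
      · simp
      · simpa [hx] using hp.1 x
    · simp only [Pi.smul_apply, smul_eq_mul, ← Finset.mul_sum]
      rw [Finset.sum_update_of_mem (Finset.mem_univ _), Finset.sdiff_singleton_eq_erase, zero_add,
        ← sub_eq_of_eq_add' hs, inv_mul_cancel₀ h2.ne']
    · rw [mix, smul_smul, mul_inv_cancel₀ h2.ne', one_smul]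
      funext x
      rcases eq_or_ne x x₀ with rfl | hx
      · simp
      · simp [hx]

/-- The output divergence per unit of mass moved away from `x₀`; it is zero for `μ = 0`, which is
the limit. -/
noncomputable def outDivRate [DecidableEq α] (W : α → β → ℝ) (x₀ : α) (μ : ℝ) (p : α → ℝ) : ℝ :=
  outDiv W x₀ (mix x₀ μ p) / μ

namespace Dominated

variable {W : α → β → ℝ} {x₀ : α} [DecidableEq α] (h : Dominated W x₀)
include h

lemma outDiv_single_self : outDiv W x₀ (Pi.single x₀ 1) = 0 := by
  rw [h.outDiv_single, divergence_self]

lemma outDiv_mix_eq_mul_rate (μ : ℝ) (p : α → ℝ) :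
    outDiv W x₀ (mix x₀ μ p) = μ * outDivRate W x₀ μ p := by
  rcases eq_or_ne μ 0 with rfl | h0
  · simp [mix, h.outDiv_single_self]
  · rw [outDivRate, mul_div_cancel₀ _ h0]

/-- Only μ = 0 matters: there the quadratic bound on the divergence squeezes the rate between 0 and
μK, in agreement with the value 0 that division by zero assigns. -/
lemma continuousOn_outDivRate : ContinuousOn (fun v : ℝ × (α → ℝ) => outDivRate W x₀ v.1 v.2)
    (Set.Icc 0 1 ×ˢ stdSimplex ℝ α) := by
  obtain ⟨K, hK, hb, -⟩ := h.exists_outDiv_mix_bounds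
  rintro ⟨μ, p⟩ ⟨hμ, hp⟩
  rcases eq_or_ne μ 0 with rfl | h0
  · have hz : outDivRate W x₀ 0 p = 0 := by simp [outDivRate]
    rw [ContinuousWithinAt, hz]
    have hlim : Tendsto (fun v : ℝ × (α → ℝ) => v.1 * K)
        (𝓝[Set.Icc 0 1 ×ˢ stdSimplex ℝ α] (0, p)) (𝓝 0) := by
      have : Continuous fun v : ℝ × (α → ℝ) => v.1 * K := by fun_prop
      simpa using (this.tendsto (0, p)).mono_left nhdsWithin_le_nhds
    refine tendsto_of_tendsto_of_tendsto_of_le_of_le' tendsto_const_nhds hlim ?_ ?_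
    · filter_upwards [self_mem_nhdsWithin] with v hv
      exact div_nonneg (h.outDiv_nonneg (mix_mem x₀ hv.1.1 hv.1.2 hv.2)) hv.1.1
    · filter_upwards [self_mem_nhdsWithin] with v hv
      rcases hv.1.1.eq_or_lt with h1 | h1
      · simp [outDivRate, ← h1]
      rw [outDivRate, div_le_iff₀ h1]
      have := h.outDiv_mix_le hv.1.1 hv.1.2 hv.2
      nlinarith [hb _ hv.2, mul_pos h1 h1]
  · refine ContinuousAt.continuousWithinAt ?_
    exact ((continuous_outDiv W x₀).comp (continuous_mix x₀)).continuousAt.div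
      continuousAt_fst h0

end Dominated

end CovertInfo

/-! ### The finite-blocklength regions as images of a compact convex set. -/

namespace CovertBC

open CovertInfo

variable {X Y₁ Y₂ Z : Type*} [Fintype Y₁] [Fintype Y₂] [Fintype Z]

namespace AbsCont

variable {C : CovertBC X Y₁ Y₂ Z} (h : C.AbsCont)
include h

lemma dominated₁ : Dominated C.W₁ C.x₀ := ⟨C.W₁_mem, h.2.1⟩
lemma dominated₂ : Dominated C.W₂ C.x₀ := ⟨C.W₂_mem, h.2.2⟩
lemma dominatedZ : Dominated C.WZ C.x₀ := ⟨C.WZ_mem, h.1⟩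

end AbsCont

variable [Fintype X]

/-- The input distribution `p` together with its information about `Y₁` and the divergence it
causes at `Y₂`. -/
noncomputable def infoPoint (C : CovertBC X Y₁ Y₂ Z) (p : X → ℝ) : (X → ℝ) × ℝ × ℝ :=
  (p, avgDiv C.W₁ C.x₀ p - outDiv C.W₁ C.x₀ p, outDiv C.W₂ C.x₀ p)

/-- The information point of `mix x₀ μ p` per unit of mass away from `x₀`, extended continuously
to `μ = 0`. -/
noncomputable def ratePoint [DecidableEq X] (C : CovertBC X Y₁ Y₂ Z) (v : ℝ × (X → ℝ)) :
    (X → ℝ) × ℝ × ℝ :=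
  (v.2, avgDiv C.W₁ C.x₀ v.2 - outDivRate C.W₁ C.x₀ v.1 v.2, outDivRate C.W₂ C.x₀ v.1 v.2)

/-- The convex hull of the information points of all input distributions. -/
noncomputable def infoHull (C : CovertBC X Y₁ Y₂ Z) : Set ((X → ℝ) × ℝ × ℝ) :=
  convexHull ℝ (C.infoPoint '' stdSimplex ℝ X)

/-- The convex hull of the rate points. -/
noncomputable def rateHull [DecidableEq X] (C : CovertBC X Y₁ Y₂ Z) : Set ((X → ℝ) × ℝ × ℝ) :=
  convexHull ℝ (C.ratePoint '' (Set.Icc 0 1 ×ˢ puncturedSimplex C.x₀))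

variable {C : CovertBC X Y₁ Y₂ Z}

lemma isCompact_infoHull : IsCompact C.infoHull := by
  refine ((isCompact_stdSimplex ℝ X).image ?_).convexHull_of_finiteDimensional
  exact continuous_id.prodMk (((continuous_avgDiv _ _).sub (continuous_outDiv _ _)).prodMk
    (continuous_outDiv _ _))

lemma infoPoint_smul (hac : C.AbsCont) (c : ℝ) (p : X → ℝ) :
    C.infoPoint (c • p) = c • C.infoPoint p := by
  simp [infoPoint, avgDiv_smul, hac.dominated₁.outDiv_smul, hac.dominated₂.outDiv_smul, mul_sub]

/-- Each slice is P_U(u) times a pmf; by homogeneity the sum is a convex combination with weights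
P_U(u). `exists_eq_sum_infoPoint` is the converse. -/
lemma sum_infoPoint_mem {υ : Type*} [Fintype υ] (hac : C.AbsCont) {P : υ × X → ℝ}
    (hP : P ∈ stdSimplex ℝ (υ × X)) : ∑ u, C.infoPoint (fun x => P (u, x)) ∈ C.infoHull := by
  have : Nonempty X := ⟨C.x₀⟩
  have h : ∀ u, ∃ q ∈ stdSimplex ℝ X, (fun x => P (u, x)) = (∑ x, P (u, x)) • q :=
    fun u => exists_eq_sum_smul fun x => hP.1 _
  choose q hq he using h
  have e : ∀ u, C.infoPoint (fun x => P (u, x)) = (∑ x, P (u, x)) • C.infoPoint (q u) :=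
    fun u => by rw [← infoPoint_smul hac, ← he u]
  simp only [e]
  refine (convex_convexHull ℝ _).sum_mem (fun u _ => Finset.sum_nonneg fun x _ => hP.1 _) ?_
    fun u _ => subset_convexHull ℝ _ ⟨q u, hq u, rfl⟩
  rw [← hP.2, Fintype.sum_prod_type]

lemma sum_infoPoint_fst {υ : Type*} [Fintype υ] (P : υ × X → ℝ) :
    (∑ u, C.infoPoint (fun x => P (u, x))).1 = marginalX P := by
  rw [Prod.fst_sum]; funext x; simp [infoPoint, marginalX]

lemma sum_infoPoint_snd_fst {υ : Type*} [Fintype υ] (hac : C.AbsCont) {P : υ × X → ℝ}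
    (hP : ∀ i, 0 ≤ P i) :
    (∑ u, C.infoPoint (fun x => P (u, x))).2.1 = infoXYgivenU P C.W₁ := by
  rw [Prod.snd_sum, Prod.fst_sum, hac.dominated₁.infoXYgivenU_eq hP]
  rfl

lemma sum_infoPoint_snd_snd {υ : Type*} [Fintype υ] (P : υ × X → ℝ) :
    (∑ u, C.infoPoint (fun x => P (u, x))).2.2 =
      ∑ u, outDiv C.W₂ C.x₀ (fun x => P (u, x)) := by
  rw [Prod.snd_sum, Prod.snd_sum]
  rfl

/-- The bounds hold at information points by Jensen and pass to the hull because `outDiv` is convex;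
they express I(X;Y₁|U) ≥ 0 and I(U;Y₂) ≥ 0. -/
lemma infoHull_bounds (hac : C.AbsCont) {v : (X → ℝ) × ℝ × ℝ} (hv : v ∈ C.infoHull) :
    v.1 ∈ stdSimplex ℝ X ∧ 0 ≤ v.2.1 ∧ outDiv C.W₂ C.x₀ v.1 ≤ v.2.2 := by
  have h2 := hac.dominated₂.convexOn_outDiv
  refine convexHull_min (t := {v : (X → ℝ) × ℝ × ℝ | v.1 ∈ stdSimplex ℝ X ∧ 0 ≤ v.2.1 ∧
    outDiv C.W₂ C.x₀ v.1 ≤ v.2.2}) ?_ ?_ hv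
  · rintro _ ⟨p, hp, rfl⟩
    exact ⟨hp, sub_nonneg.2 (hac.dominated₁.outDiv_le_avgDiv hp), le_rfl⟩
  · rintro v ⟨a1, a2, a3⟩ w ⟨b1, b2, b3⟩ a b ha hb hab
    refine ⟨h2.1 a1 b1 ha hb hab, ?_, (h2.2 a1 b1 ha hb hab).trans ?_⟩
    · simp only [Prod.snd_add, Prod.fst_add, Prod.smul_snd, Prod.smul_fst, smul_eq_mul]
      positivity
    · simp only [Prod.snd_add, Prod.smul_snd, smul_eq_mul]
      gcongr

lemma exists_eq_sum_infoPoint (hac : C.AbsCont) {v : (X → ℝ) × ℝ × ℝ} (hv : v ∈ C.infoHull) :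
    ∃ (m : ℕ) (P : Fin m × X → ℝ), P ∈ stdSimplex ℝ (Fin m × X) ∧
      v = ∑ u, C.infoPoint (fun x => P (u, x)) := by
  obtain ⟨ι, _, w, z, hw, hw1, hz, rfl⟩ := mem_convexHull_iff_exists_fintype.1 hv
  choose p hp hpz using hz
  set e := Fintype.equivFin ι
  refine ⟨Fintype.card ι, fun i => w (e.symm i.1) * p (e.symm i.1) i.2,
    ⟨fun i => mul_nonneg (hw _) ((hp _).1 _), ?_⟩, ?_⟩
  · rw [Fintype.sum_prod_type]
    simp only [← Finset.mul_sum, (hp _).2, mul_one]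
    rw [e.symm.sum_comp w, hw1]
  · rw [← e.symm.sum_comp]
    refine Finset.sum_congr rfl fun i _ => ?_
    rw [← hpz, ← infoPoint_smul hac]
    rfl

/-- The region at blocklength `n` in terms of the hull of information points. -/
lemma mem_regionAt_iff (hac : C.AbsCont) {δ : ℝ} {n : ℕ} {L : ℝ × ℝ} :
    L ∈ C.regionAt δ n ↔ 0 ≤ L ∧
      ∃ v ∈ C.infoHull ∩ {v | outDiv C.WZ C.x₀ v.1 ≤ δ / n},
        L ≤ (√(n / δ) * v.2.1, √(n / δ) * (v.2.2 - outDiv C.W₂ C.x₀ v.1)) := by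
  constructor
  · rintro ⟨h1, h2, m, P, hP, hD, hL1, hL2⟩
    have hm := sum_infoPoint_mem hac hP
    refine ⟨⟨h1, h2⟩, _, ⟨hm, ?_⟩, ?_, ?_⟩
    · rw [Set.mem_ofPred_eq, hac.dominatedZ.outDiv_eq_divergence (infoHull_bounds hac hm).1.2,
        sum_infoPoint_fst]
      exact hD
    · rw [sum_infoPoint_snd_fst hac hP.1]
      exact hL1
    · rw [sum_infoPoint_snd_snd, sum_infoPoint_fst, ← hac.dominated₂.infoUY_eq hP]
      exact hL2
  · rintro ⟨h0, v, ⟨hv, hD⟩, hL1, hL2⟩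
    obtain ⟨m, P, hP, rfl⟩ := exists_eq_sum_infoPoint hac hv
    refine ⟨h0.1, h0.2, m, P, hP, ?_, ?_, ?_⟩
    · rw [Set.mem_ofPred_eq, hac.dominatedZ.outDiv_eq_divergence (infoHull_bounds hac hv).1.2,
        sum_infoPoint_fst] at hD
      exact hD
    · rw [sum_infoPoint_snd_fst hac hP.1] at hL1
      exact hL1
    · rw [sum_infoPoint_snd_snd, sum_infoPoint_fst, ← hac.dominated₂.infoUY_eq hP] at hL2
      exact hL2

lemma isClosed_regionAt (hac : C.AbsCont) (δ : ℝ) (n : ℕ) : IsClosed (C.regionAt δ n) := by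
  have e : C.regionAt δ n = Set.Ici 0 ∩ _ := Set.ext fun L => mem_regionAt_iff hac
  rw [e]
  have hc := (continuous_outDiv C.WZ C.x₀).comp (continuous_fst (X := X → ℝ) (Y := ℝ × ℝ))
  have hc2 := (continuous_outDiv C.W₂ C.x₀).comp (continuous_fst (X := X → ℝ) (Y := ℝ × ℝ))
  refine isClosed_Ici.inter (IsCompact.isClosed_setOf_exists_le
    (isCompact_infoHull.inter_right (isClosed_le hc continuous_const)) ?_)
  refine Continuous.continuousOn (Continuous.prodMk (by fun_prop) ?_)
  exact continuous_const.mul (Continuous.sub (by fun_prop) hc2)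

end CovertBC

/-! ### Converse: the outer limit lies in the rate region. -/

namespace CovertBC

open CovertInfo

variable {X Y₁ Y₂ Z : Type*} [Fintype X] [Fintype Y₁] [Fintype Y₂] [Fintype Z]
  [DecidableEq X] {C : CovertBC X Y₁ Y₂ Z}

/-- The covertness cost of the direction `p`, per squared mass away from `x₀`. -/
noncomputable def cost (C : CovertBC X Y₁ Y₂ Z) (p : X → ℝ) : ℝ :=
  chiSq (output p C.WZ) (C.WZ C.x₀)

/-- The rate pairs that are dominated by a normalized point of the hull of rate points. -/
noncomputable def rateRegion (C : CovertBC X Y₁ Y₂ Z) : Set (ℝ × ℝ) :=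
  Set.Ici 0 ∩ {L | ∃ v ∈ C.rateHull, L ≤ √(2 / C.cost v.1) • v.2}

omit [DecidableEq X] in
lemma continuous_cost : Continuous C.cost := continuous_chiSq_output _ _

lemma isCompact_rateHull (hac : C.AbsCont) : IsCompact C.rateHull := by
  refine ((isCompact_Icc.prod (isCompact_puncturedSimplex C.x₀)).image_of_continuousOn
    ?_).convexHull_of_finiteDimensional
  have hs : Set.Icc (0 : ℝ) 1 ×ˢ puncturedSimplex C.x₀ ⊆ Set.Icc 0 1 ×ˢ stdSimplex ℝ X :=
    Set.prod_mono_right Set.inter_subset_left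
  exact continuousOn_snd.prodMk ((((continuous_avgDiv C.W₁ C.x₀).comp
    continuous_snd).continuousOn.sub (hac.dominated₁.continuousOn_outDivRate.mono hs)).prodMk
    (hac.dominated₂.continuousOn_outDivRate.mono hs))

lemma rateHull_bounds (hac : C.AbsCont) {v : (X → ℝ) × ℝ × ℝ} (hv : v ∈ C.rateHull) :
    v.1 ∈ puncturedSimplex C.x₀ ∧ 0 ≤ v.2 := by
  refine convexHull_min (t := puncturedSimplex C.x₀ ×ˢ Set.Ici 0) ?_
    ((convex_puncturedSimplex _).prod (convex_Ici _)) hv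
  rintro _ ⟨⟨μ, p⟩, ⟨⟨h0, h1⟩, hp⟩, rfl⟩
  have hm := mix_mem C.x₀ h0 h1 hp.1
  have hle : outDivRate C.W₁ C.x₀ μ p ≤ avgDiv C.W₁ C.x₀ p := by
    have hp1 := hac.dominated₁.outDiv_le_avgDiv hm
    rw [avgDiv_mix] at hp1
    dsimp only at h0
    rcases h0.eq_or_lt with rfl | h0
    · simpa [outDivRate] using
        (hac.dominated₁.outDiv_nonneg hp.1).trans (hac.dominated₁.outDiv_le_avgDiv hp.1)
    · rw [outDivRate, div_le_iff₀ h0]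
      linarith
  exact ⟨hp, sub_nonneg.2 hle, div_nonneg (hac.dominated₂.outDiv_nonneg hm) h0⟩

/-- `avgDiv` is linear and vanishes at x₀, and `outDiv` of the mixture is μ times its rate; hence
the segment from the base point. -/
lemma infoPoint_mix (hac : C.AbsCont) (μ : ℝ) (p : X → ℝ) :
    C.infoPoint (mix C.x₀ μ p) =
      (1 - μ) • (Pi.single C.x₀ 1, 0) + μ • C.ratePoint (μ, p) := by
  refine Prod.ext ?_ (Prod.ext ?_ ?_)
  · simp [infoPoint, ratePoint, mix]
  · simp [infoPoint, ratePoint, avgDiv_mix, hac.dominated₁.outDiv_mix_eq_mul_rate, mul_sub]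
  · simp [infoPoint, ratePoint, hac.dominated₂.outDiv_mix_eq_mul_rate]

lemma base_mem_infoHull (hac : C.AbsCont) : (Pi.single C.x₀ 1, 0) ∈ C.infoHull := by
  refine subset_convexHull ℝ _ ⟨_, single_mem_stdSimplex ℝ C.x₀, ?_⟩
  simp [infoPoint, avgDiv_single, divergence_self, hac.dominated₁.outDiv_single_self,
    hac.dominated₂.outDiv_single_self]

lemma rateHull_nonempty [Nontrivial X] : C.rateHull.Nonempty := by
  obtain ⟨p, hp⟩ := puncturedSimplex_nonempty C.x₀
  exact ⟨_, subset_convexHull ℝ _ ⟨(0, p), ⟨by simp, hp⟩, rfl⟩⟩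

lemma exists_rate_decomposition [Nontrivial X] {w : (X → ℝ) × ℝ × ℝ}
    (hw : w ∈ convexHull ℝ (insert (Pi.single C.x₀ 1, 0) C.rateHull)) :
    ∃ μ ∈ Set.Icc (0 : ℝ) 1, ∃ v ∈ C.rateHull, w = (mix C.x₀ μ v.1, μ • v.2) := by
  rw [convexHull_insert rateHull_nonempty, mem_convexJoin] at hw
  obtain ⟨a, rfl, v, hv, hw⟩ := hw
  rw [rateHull, (convex_convexHull ℝ _).convexHull_eq, ← rateHull] at hv
  rw [segment_eq_image] at hw
  obtain ⟨μ, hμ, rfl⟩ := hw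
  refine ⟨μ, hμ, v, hv, Prod.ext ?_ ?_⟩ <;> simp [mix]

lemma infoPoint_mem_convexHull_insert [Nontrivial X] (hac : C.AbsCont) {p : X → ℝ}
    (hp : p ∈ stdSimplex ℝ X) :
    C.infoPoint p ∈ convexHull ℝ (insert (Pi.single C.x₀ 1, 0) C.rateHull) := by
  obtain ⟨μ, hμ, q, hq, rfl⟩ := exists_eq_mix C.x₀ hp
  rw [infoPoint_mix hac]
  refine convex_convexHull ℝ _ (subset_convexHull ℝ _ (Set.mem_insert _ _))
    (subset_convexHull ℝ _ (Set.mem_insert_of_mem _ ?_)) (by linarith [hμ.2]) hμ.1 (by ring)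
  exact subset_convexHull ℝ _ ⟨(μ, q), ⟨hμ, hq⟩, rfl⟩

lemma infoHull_subset [Nontrivial X] (hac : C.AbsCont) :
    C.infoHull ⊆ convexHull ℝ (insert (Pi.single C.x₀ 1, 0) C.rateHull) := by
  refine convexHull_min ?_ (convex_convexHull ℝ _)
  rintro _ ⟨p, hp, rfl⟩
  exact infoPoint_mem_convexHull_insert hac hp

omit [DecidableEq X] in
-- Zero cost would mean that inputs other than x₀ reproduce Q₀ as a convex combination.
lemma cost_pos (hred : C.NonRedundant) (hac : C.AbsCont) {p : X → ℝ}
    (hp : p ∈ puncturedSimplex C.x₀) : 0 < C.cost p := by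
  classical
  have hn := fun z => (C.WZ_mem C.x₀).1 z
  refine (chiSq_nonneg hn).lt_of_ne fun h0 => hred ?_
  have ho : output p C.WZ = C.WZ C.x₀ := by
    funext z
    have h1 := (Finset.sum_eq_zero_iff_of_nonneg fun z _ =>
      div_nonneg (sq_nonneg _) (hn z)).1 h0.symm z (Finset.mem_univ z)
    rcases div_eq_zero_iff.1 h1 with h2 | h2
    · exact sub_eq_zero.1 (pow_eq_zero_iff two_ne_zero |>.1 h2)
    · rw [h2, hac.dominatedZ.output_eq_zero p h2]
  have hz : p C.x₀ = 0 := hp.2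
  have e : C.WZ C.x₀ = ∑ x ∈ Finset.univ.erase C.x₀, p x • C.WZ x := by
    rw [← ho, Finset.sum_erase _ (by rw [hz, zero_smul])]
    funext z
    simp [output]
  rw [e]
  refine (convex_convexHull ℝ _).sum_mem (fun x _ => hp.1.1 x) ?_ fun x hx =>
    subset_convexHull ℝ _ ⟨x, (Finset.mem_erase.1 hx).1, rfl⟩
  rw [Finset.sum_erase _ hz, hp.1.2]

omit [DecidableEq X] in
lemma exists_cost_lower_bound [Nontrivial X] (hred : C.NonRedundant) (hac : C.AbsCont) :
    ∃ κ, 0 < κ ∧ ∀ p ∈ puncturedSimplex C.x₀, κ ≤ C.cost p := by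
  obtain ⟨p, hp, hmin⟩ := (isCompact_puncturedSimplex C.x₀).exists_isMinOn
    (puncturedSimplex_nonempty C.x₀) (continuous_cost (C := C)).continuousOn
  exact ⟨_, cost_pos hred hac hp, hmin⟩

lemma isClosed_rateRegion (hred : C.NonRedundant) (hac : C.AbsCont) : IsClosed C.rateRegion := by
  have hc : Continuous fun v : (X → ℝ) × ℝ × ℝ => C.cost v.1 :=
    continuous_cost.comp continuous_fst
  have hf : ContinuousOn (fun v : (X → ℝ) × ℝ × ℝ => √(2 / C.cost v.1) • v.2) C.rateHull :=
    ContinuousOn.smul (Real.continuous_sqrt.comp_continuousOn (continuousOn_const.div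
      hc.continuousOn fun v hv => (cost_pos hred hac (rateHull_bounds hac hv).1).ne'))
      continuousOn_snd
  exact isClosed_Ici.inter ((isCompact_rateHull hac).isClosed_setOf_exists_le hf)

/-- For large blocklengths, the covertness constraint bounds the mass away from `x₀`. -/
lemma eventually_mass_le [Nontrivial X] (hred : C.NonRedundant) (hac : C.AbsCont) {δ : ℝ}
    (hδ : 0 < δ) {ε : ℝ} (hε : 0 < ε) :
    ∀ᶠ n : ℕ in atTop, ∀ μ ∈ Set.Icc (0 : ℝ) 1, ∀ p ∈ puncturedSimplex C.x₀,
      outDiv C.WZ C.x₀ (mix C.x₀ μ p) ≤ δ / n → √(n / δ) * μ ≤ (1 + ε) * √(2 / C.cost p) := by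
  obtain ⟨K, hK, -, hlow, hasy⟩ := hac.dominatedZ.exists_outDiv_mix_bounds
  obtain ⟨κ, hκ, hκle⟩ := exists_cost_lower_bound hred hac
  -- For μ ≤ η the expansion is valid, and twice its cubic error is at most the fraction ε/(1+ε) of
  -- μ² times the cost.
  set η := min (1 / K) (κ * ε / (2 * K * (1 + ε)))
  have hη : 0 < η := by positivity
  filter_upwards [eventually_ge_atTop (⌈K * δ / (κ * η ^ 2)⌉₊), eventually_gt_atTop 0]
    with n hn hn0 μ hμ p hp hD
  have hn0' : (0 : ℝ) < n := by exact_mod_cast hn0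
  have hX := cost_pos hred hac hp
  have hXκ := hκle p hp
  -- The crude bound gives μ²κ ≤ Kδ/n, which is at most κη² by the choice of n.
  have hμη : μ ≤ η := by
    have h1 := hlow μ hμ.1 hμ.2 p hp.1
    have h2 : K * δ / (κ * η ^ 2) ≤ n := (Nat.le_ceil _).trans (by exact_mod_cast hn)
    rw [div_le_iff₀ (by positivity)] at h2
    have h3 : μ ^ 2 * κ ≤ K * (δ / n) :=
      (mul_le_mul_of_nonneg_left hXκ (sq_nonneg μ)).trans (h1.trans (by gcongr))
    have h4 : K * (δ / n) ≤ η ^ 2 * κ := by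
      rw [← mul_div_assoc, div_le_iff₀ hn0']
      linarith
    exact (pow_le_pow_iff_left₀ hμ.1 hη.le two_ne_zero).1
      (le_of_mul_le_mul_right (h3.trans h4) hκ)
  have hK1 : μ * K ≤ 1 := by
    have := hμη.trans (min_le_left _ _)
    rwa [le_div_iff₀ hK] at this
  have hK2 : μ * (2 * K * (1 + ε)) ≤ κ * ε := by
    have := hμη.trans (min_le_right _ _)
    rwa [le_div_iff₀ (by positivity)] at this
  have h5 := (abs_le.1 (hasy μ hμ.1 hK1 p hp.1)).1
  change -(K * μ ^ 3) ≤ _ - μ ^ 2 * C.cost p / 2 at h5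
  have h6 : μ ^ 2 * C.cost p ≤ (1 + ε) ^ 2 * (2 * (δ / n)) := by
    have h7 : 2 * K * μ ^ 3 * (1 + ε) ≤ μ ^ 2 * C.cost p * ε := by
      have := mul_le_mul_of_nonneg_left hK2 (sq_nonneg μ)
      have h8 : μ ^ 2 * (κ * ε) ≤ μ ^ 2 * (C.cost p * ε) := by gcongr
      nlinarith
    have h9 : μ ^ 2 * C.cost p ≤ 2 * (δ / n) + 2 * K * μ ^ 3 := by linarith
    have h10 : μ ^ 2 * C.cost p * (1 + ε) ≤ 2 * (δ / n) * (1 + ε) + μ ^ 2 * C.cost p * ε := by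
      nlinarith
    have h11 : 0 ≤ δ / n := by positivity
    nlinarith [mul_nonneg h11 hε.le, mul_nonneg h11 (sq_nonneg ε)]
  refine (pow_le_pow_iff_left₀ (mul_nonneg (Real.sqrt_nonneg _) hμ.1) (by positivity)
    two_ne_zero).1 ?_
  rw [mul_pow, mul_pow, Real.sq_sqrt (by positivity), Real.sq_sqrt (by positivity),
    ← mul_div_assoc, le_div_iff₀ hX]
  calc n / δ * μ ^ 2 * C.cost p = n / δ * (μ ^ 2 * C.cost p) := by ring
    _ ≤ n / δ * ((1 + ε) ^ 2 * (2 * (δ / n))) := by gcongr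
    _ = (1 + ε) ^ 2 * 2 := by field_simp

/-- The divergence subtracted in I(U;Y₂) is nonnegative and is dropped; what remains is μ times a
point of `rateHull`, and `eventually_mass_le` bounds the scaled μ. -/
lemma eventually_regionAt_subset [Nontrivial X] (hred : C.NonRedundant) (hac : C.AbsCont)
    {δ : ℝ} (hδ : 0 < δ) {ε : ℝ} (hε : 0 < ε) :
    ∀ᶠ n : ℕ in atTop, C.regionAt δ n ⊆ {L | (1 + ε)⁻¹ • L ∈ C.rateRegion} := by
  filter_upwards [eventually_mass_le hred hac hδ hε] with n hn L hL
  obtain ⟨h0, w, ⟨hw, hD⟩, hLw⟩ := (mem_regionAt_iff hac).1 hL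
  have h2 := hac.dominated₂.outDiv_nonneg (infoHull_bounds hac hw).1
  obtain ⟨μ, hμ, v, hv, rfl⟩ := exists_rate_decomposition (infoHull_subset hac hw)
  obtain ⟨hp, hv0⟩ := rateHull_bounds hac hv
  have hε' : 0 < 1 + ε := by linarith
  refine ⟨smul_nonneg (by positivity) h0, v, hv, ?_⟩
  rw [inv_smul_le_iff_of_pos hε', smul_smul]
  refine le_trans ?_ (smul_le_smul_of_nonneg_right (hn μ hμ v.1 hp hD) hv0)
  refine hLw.trans ⟨?_, ?_⟩
  · simp [mul_assoc]
  · simp only [Prod.smul_snd, smul_eq_mul, mul_assoc]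
    gcongr
    linarith

lemma outerLimitRegion_subset [Nontrivial X] (hred : C.NonRedundant) (hac : C.AbsCont)
    {δ : ℝ} (hδ : 0 < δ) : C.outerLimitRegion δ ⊆ C.rateRegion := by
  intro L hL
  have hcl := isClosed_rateRegion hred hac
  have key : ∀ ε : ℝ, 0 < ε → (1 + ε)⁻¹ • L ∈ C.rateRegion := by
    intro ε hε
    obtain ⟨N, hN⟩ := eventually_atTop.1 (eventually_regionAt_subset hred hac hδ hε)
    have hcl' : IsClosed {L : ℝ × ℝ | (1 + ε)⁻¹ • L ∈ C.rateRegion} :=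
      hcl.preimage (continuous_const_smul _)
    simp only [outerLimitRegion, Set.mem_iInter] at hL
    refine closure_minimal ?_ hcl' (hL (N + 1) (by omega))
    exact Set.iUnion₂_subset fun n hn => hN n (by omega)
  have hlim : Tendsto (fun ε : ℝ => (1 + ε)⁻¹ • L) (𝓝[>] 0) (𝓝 L) := by
    have : ContinuousAt (fun ε : ℝ => (1 + ε)⁻¹ • L) 0 :=
      ((continuousAt_const.add continuousAt_id).inv₀ (by simp)).smul continuousAt_const
    simpa using this.tendsto.mono_left nhdsWithin_le_nhds
  exact hcl.mem_of_tendsto hlim (by filter_upwards [self_mem_nhdsWithin] with ε hε using key ε hε)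

end CovertBC

/-! ### Achievability, and the relations between the limits. -/

namespace CovertBC

open CovertInfo

variable {X Y₁ Y₂ Z : Type*} [Fintype X] [Fintype Y₁] [Fintype Y₂] [Fintype Z]
  [DecidableEq X] {C : CovertBC X Y₁ Y₂ Z}

/-- To first order in `μ`, every point of the hull of rate points is attained by an information
point whose input distribution has mass `μ` away from `x₀`. -/
lemma exists_mem_infoHull_near (hac : C.AbsCont) {v : (X → ℝ) × ℝ × ℝ} (hv : v ∈ C.rateHull)
    {ε : ℝ} (hε : 0 < ε) :
    ∃ μ₀, 0 < μ₀ ∧ ∀ μ, 0 < μ → μ ≤ μ₀ → ∃ w ∈ C.infoHull, w.1 = mix C.x₀ μ v.1 ∧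
      μ * (v.2.1 - ε) ≤ w.2.1 ∧ μ * (v.2.2 - ε) ≤ w.2.2 := by
  refine convexHull_min (t := {v : (X → ℝ) × ℝ × ℝ | ∃ μ₀, 0 < μ₀ ∧ ∀ μ, 0 < μ → μ ≤ μ₀ →
    ∃ w ∈ C.infoHull, w.1 = mix C.x₀ μ v.1 ∧ μ * (v.2.1 - ε) ≤ w.2.1 ∧
      μ * (v.2.2 - ε) ≤ w.2.2}) ?_ ?_ hv
  · rintro _ ⟨⟨a, p⟩, ⟨⟨ha0, ha1⟩, hp⟩, rfl⟩
    dsimp only at ha0 ha1 hp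
    rcases ha0.eq_or_lt with rfl | ha
    -- At a limiting rate point the mixture of mass μ itself works: the information lost is at most
    -- Kμ² ≤ εμ.
    · obtain ⟨K, hK, hb, -⟩ := hac.dominated₁.exists_outDiv_mix_bounds
      refine ⟨min 1 (ε / K), by positivity, fun μ hμ hμ₀ => ?_⟩
      have hμ1 := hμ₀.trans (min_le_left _ _)
      have hμK := hμ₀.trans (min_le_right _ _)
      rw [le_div_iff₀ hK] at hμK
      have hm := mix_mem C.x₀ hμ.le hμ1 hp.1
      refine ⟨C.infoPoint (mix C.x₀ μ p), subset_convexHull ℝ _ ⟨_, hm, rfl⟩, rfl, ?_, ?_⟩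
      · simp only [infoPoint, ratePoint, avgDiv_mix, outDivRate, div_zero, sub_zero]
        have h1 := hac.dominated₁.outDiv_mix_le hμ.le hμ1 hp.1
        have h2 := mul_le_mul_of_nonneg_left (hb p hp.1) (sq_nonneg μ)
        nlinarith
      · simp only [infoPoint, ratePoint, outDivRate, div_zero]
        have := hac.dominated₂.outDiv_nonneg hm
        nlinarith
    -- For a > 0, time sharing of the mixture of mass a with the base point, in proportion μ/a,
    -- attains the rate without loss.
    · refine ⟨a, ha, fun μ hμ hμa => ?_⟩
      have hle : μ / a ≤ 1 := (div_le_one₀ ha).2 hμa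
      have h0 : 0 ≤ μ / a := by positivity
      have e : (1 - μ / a) • ((Pi.single C.x₀ 1, 0) : (X → ℝ) × ℝ × ℝ) +
          (μ / a) • C.infoPoint (mix C.x₀ a p) =
          (1 - μ) • (Pi.single C.x₀ 1, 0) + μ • C.ratePoint (a, p) := by
        rw [infoPoint_mix hac, smul_add, smul_smul, smul_smul, ← add_assoc, ← add_smul,
          div_mul_cancel₀ _ ha.ne']
        congr 2
        field_simp
        ring
      refine ⟨_, (convex_convexHull ℝ _) (base_mem_infoHull hac) (subset_convexHull ℝ _
        ⟨_, mix_mem C.x₀ ha0 ha1 hp.1, rfl⟩) (sub_nonneg.2 hle) h0 (by ring), ?_⟩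
      have e2 : ((1 - μ) • ((Pi.single C.x₀ 1, 0) : (X → ℝ) × ℝ × ℝ) + μ • C.ratePoint (a, p)).2 =
        μ • (C.ratePoint (a, p)).2 := by simp
      rw [e, e2]
      refine ⟨by simp [mix, ratePoint], ?_, ?_⟩ <;>
        exact mul_le_mul_of_nonneg_left (by linarith) hμ.le
  · rintro v ⟨μ₁, h1, H1⟩ w ⟨μ₂, h2, H2⟩ a b ha hb hab
    refine ⟨min μ₁ μ₂, lt_min h1 h2, fun μ hμ hle => ?_⟩
    obtain ⟨v', hv', e1, s1, t1⟩ := H1 μ hμ (hle.trans (min_le_left _ _))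
    obtain ⟨w', hw', e2, s2, t2⟩ := H2 μ hμ (hle.trans (min_le_right _ _))
    refine ⟨_, (convex_convexHull ℝ _) hv' hw' ha hb hab, ?_, ?_, ?_⟩
    · rw [Prod.fst_add, Prod.smul_fst, Prod.smul_fst, e1, e2]
      obtain rfl : a = 1 - b := by linarith
      simp only [mix, Prod.fst_add, Prod.smul_fst]
      module
    · simp only [Prod.snd_add, Prod.fst_add, Prod.smul_snd, Prod.smul_fst, smul_eq_mul]
      obtain rfl : a = 1 - b := by linarith
      linarith [mul_le_mul_of_nonneg_left s1 ha, mul_le_mul_of_nonneg_left s2 hb]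
    · simp only [Prod.snd_add, Prod.smul_snd, smul_eq_mul]
      obtain rfl : a = 1 - b := by linarith
      linarith [mul_le_mul_of_nonneg_left t1 ha, mul_le_mul_of_nonneg_left t2 hb]

/-- The factor 1 - ε will pay for the cubic error in the covertness constraint, one ε for
approximating the rate point, the other for the divergence subtracted at Y₂. -/
lemma exists_loss {k s t η : ℝ} (hη : 0 < η) : ∃ ε : ℝ, 0 < ε ∧ ε < 1 ∧
    k * s - η ≤ (1 - ε) * k * (s - 2 * ε) ∧ k * t - η ≤ (1 - ε) * k * (t - 2 * ε) := by
  have hlim : ∀ r : ℝ, ∀ᶠ ε in 𝓝[>] (0 : ℝ), k * r - η ≤ (1 - ε) * k * (r - 2 * ε) := fun r => by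
    have hc : Continuous fun ε : ℝ => (1 - ε) * k * (r - 2 * ε) := by fun_prop
    have h0 := (hc.tendsto 0).mono_left (nhdsWithin_le_nhds (s := Set.Ioi 0))
    refine (h0.eventually_const_lt (u := k * r - η) ?_).mono fun _ h => h.le
    simp [hη]
  have h1 : ∀ᶠ ε in 𝓝[>] (0 : ℝ), ε < 1 :=
    nhdsWithin_le_nhds (eventually_lt_nhds one_pos)
  obtain ⟨ε, ⟨⟨ha, hb⟩, hc⟩, hd⟩ :=
    (((hlim s).and (hlim t)).and h1 |>.and self_mem_nhdsWithin).exists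
  exact ⟨ε, hd, hc, ha, hb⟩

lemma eventually_exists_regionAt_near (hred : C.NonRedundant) (hac : C.AbsCont) {δ : ℝ}
    (hδ : 0 < δ) {L : ℝ × ℝ} (hL : L ∈ C.rateRegion) {η : ℝ} (hη : 0 < η) :
    ∀ᶠ n : ℕ in atTop, ∃ L' ∈ C.regionAt δ n, dist L L' ≤ η := by
  obtain ⟨hL0, v, hv, hLv⟩ := hL
  obtain ⟨hp, -⟩ := rateHull_bounds hac hv
  have hX := cost_pos hred hac hp
  set A := C.cost v.1 with hA
  obtain ⟨ε, hε, hε1, hs, ht⟩ := exists_loss (k := √(2 / A)) (s := v.2.1) (t := v.2.2) hη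
  obtain ⟨μ₀, hμ₀, H⟩ := exists_mem_infoHull_near hac hv hε
  obtain ⟨K, hK, -, -, hasy⟩ := hac.dominatedZ.exists_outDiv_mix_bounds
  obtain ⟨K₂, hK₂, hb₂, -⟩ := hac.dominated₂.exists_outDiv_mix_bounds
  -- Below ρ the approximating point exists, the mixture is a pmf, the expansion holds, the
  -- divergence at Y₂ is at most με, and the cubic error is at most ε times the quadratic term.
  set ρ := min (min μ₀ 1) (min (1 / K) (min (ε / K₂) (ε * A / (2 * K))))
  have hρ : 0 < ρ := by positivity
  have hlim : Tendsto (fun n : ℕ => (1 - ε) * √(2 / A) * √(δ / n)) atTop (𝓝 0) := by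
    have h1 : Tendsto (fun n : ℕ => √(δ / n)) atTop (𝓝 0) := by
      rw [← Real.sqrt_zero]
      exact (Real.continuous_sqrt.tendsto 0).comp (tendsto_const_div_atTop_nhds_zero_nat δ)
    simpa using h1.const_mul ((1 - ε) * √(2 / A))
  filter_upwards [hlim.eventually_le_const hρ, eventually_gt_atTop 0] with n hn hn0
  have hn0' : (0 : ℝ) < n := by exact_mod_cast hn0
  have hε' : 0 < 1 - ε := by linarith
  -- This is 1 - ε times the mass whose quadratic term μ²A/2 equals δ/n.
  set μ := (1 - ε) * √(2 / A) * √(δ / n) with hμdef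
  have hμ : 0 < μ := by positivity
  have hle := le_min_iff.1 hn
  have hle1 := le_min_iff.1 hle.1
  have hle2 := le_min_iff.1 hle.2
  have hle3 := le_min_iff.1 hle2.2
  have hμK : μ * K ≤ 1 := (le_div_iff₀ hK).1 hle2.1
  have hμK₂ : μ * K₂ ≤ ε := (le_div_iff₀ hK₂).1 hle3.1
  have hμA : μ * (2 * K) ≤ ε * A := (le_div_iff₀ (by positivity)).1 hle3.2
  have hμsq : μ ^ 2 * A = (1 - ε) ^ 2 * (2 * (δ / n)) := by
    rw [hμdef, mul_pow, mul_pow, Real.sq_sqrt (by positivity), Real.sq_sqrt (by positivity)]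
    field_simp
  have hcμ : √(n / δ) * μ = (1 - ε) * √(2 / A) := by
    have : √(n / δ) * √(δ / n) = 1 := by
      rw [← Real.sqrt_mul (by positivity), div_mul_div_comm, mul_comm, div_self (by positivity),
        Real.sqrt_one]
    rw [hμdef]
    linear_combination (1 - ε) * √(2 / A) * this
  obtain ⟨w, hw, hw1, hws, hwt⟩ := H μ hμ hle1.1
  have hD : outDiv C.WZ C.x₀ w.1 ≤ δ / n := by
    rw [hw1]
    have h1 := (abs_le.1 (hasy μ hμ.le hμK v.1 hp.1)).2
    change _ - μ ^ 2 * A / 2 ≤ _ at h1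
    have h2 : K * μ ^ 3 ≤ μ ^ 2 * A / 2 * ε := by
      have := mul_le_mul_of_nonneg_left hμA (sq_nonneg μ)
      linarith
    have h3 : (1 - ε) ^ 2 * (1 + ε) ≤ 1 := by
      have := mul_nonneg hε.le (add_nonneg zero_le_one (mul_nonneg hε.le hε'.le))
      linarith
    have h4 : (1 - ε) ^ 2 * (1 + ε) * (δ / n) ≤ 1 * (δ / n) := by gcongr
    have h5 : μ ^ 2 * A / 2 * (1 + ε) = (1 - ε) ^ 2 * (1 + ε) * (δ / n) := by
      linear_combination (1 + ε) / 2 * hμsq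
    linarith
  have hinfo := infoHull_bounds hac hw
  have hG : outDiv C.W₂ C.x₀ w.1 ≤ μ * ε := by
    rw [hw1]
    have h1 := hac.dominated₂.outDiv_mix_le hμ.le hle1.2 hp.1
    have h2 := mul_le_mul_of_nonneg_left (hb₂ v.1 hp.1) (sq_nonneg μ)
    have h3 := mul_le_mul_of_nonneg_left hμK₂ hμ.le
    linarith
  have hc : 0 ≤ √(n / δ) := Real.sqrt_nonneg _
  have hk : 0 ≤ (1 - ε) * √(2 / A) := by positivity
  -- Truncation at 0 keeps the pair nonnegative and moves L by at most η.
  refine ⟨(max 0 (L.1 - η), max 0 (L.2 - η)), (mem_regionAt_iff hac).2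
    ⟨⟨le_max_left _ _, le_max_left _ _⟩, w, ⟨hw, hD⟩, max_le ?_ ?_, max_le ?_ ?_⟩, ?_⟩
  · exact mul_nonneg hc hinfo.2.1
  · have h1 : √(n / δ) * (μ * (v.2.1 - ε)) ≤ √(n / δ) * w.2.1 := by gcongr
    rw [← mul_assoc, hcμ] at h1
    have h2 : L.1 ≤ √(2 / A) * v.2.1 := hLv.1
    have h3 := mul_nonneg hk hε.le
    dsimp only
    linarith
  · exact mul_nonneg hc (sub_nonneg.2 hinfo.2.2)
  · have h1 : √(n / δ) * (μ * (v.2.2 - 2 * ε)) ≤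
        √(n / δ) * (w.2.2 - outDiv C.W₂ C.x₀ w.1) := by
      gcongr
      linarith
    rw [← mul_assoc, hcμ] at h1
    have h2 : L.2 ≤ √(2 / A) * v.2.2 := hLv.2
    dsimp only
    linarith
  · have hd : ∀ x : ℝ, 0 ≤ x → dist x (max 0 (x - η)) ≤ η := fun x hx => by
      rw [Real.dist_eq, abs_le]
      constructor <;> rcases max_cases 0 (x - η) with ⟨h, -⟩ | ⟨h, -⟩ <;> rw [h] <;>
        linarith [max_cases 0 (x - η), le_max_right 0 (x - η)]
    exact max_le (hd _ hL0.1) (hd _ hL0.2)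

lemma zero_mem_regionAt (hac : C.AbsCont) {δ : ℝ} (hδ : 0 < δ) (n : ℕ) :
    (0 : ℝ × ℝ) ∈ C.regionAt δ n := by
  refine (mem_regionAt_iff hac).2 ⟨le_rfl, _, ⟨base_mem_infoHull hac, ?_⟩, ?_⟩
  · rw [Set.mem_ofPred_eq, hac.dominatedZ.outDiv_single_self]
    positivity
  · simp [hac.dominated₂.outDiv_single_self, ← Prod.zero_eq_mk]

/-- Nearest points of the closed nonempty regions form a single sequence good for every tolerance,
so no diagonal choice is needed. -/
lemma rateRegion_subset_limitRegion (hred : C.NonRedundant) (hac : C.AbsCont) {δ : ℝ}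
    (hδ : 0 < δ) : C.rateRegion ⊆ C.limitRegion δ := by
  intro L hL
  have hne : ∀ n, (C.regionAt δ n).Nonempty := fun n => ⟨0, zero_mem_regionAt hac hδ n⟩
  choose p hp hd using fun n =>
    (isClosed_regionAt hac δ n).exists_infDist_eq_dist (hne n) L
  refine ⟨p, fun n _ => hp n, Metric.tendsto_atTop.2 fun η hη => ?_⟩
  obtain ⟨N, hN⟩ := eventually_atTop.1
    (eventually_exists_regionAt_near hred hac hδ hL (half_pos hη))
  refine ⟨N, fun n hn => ?_⟩
  obtain ⟨L', hL', hdist⟩ := hN n hn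
  rw [dist_comm, ← hd]
  exact ((Metric.infDist_le_dist_of_mem hL').trans hdist).trans_lt (half_lt_self hη)

omit [DecidableEq X] in
lemma limitRegion_subset_outerLimitRegion (δ : ℝ) :
    C.limitRegion δ ⊆ C.outerLimitRegion δ := by
  rintro L ⟨p, hp, hlim⟩
  simp only [outerLimitRegion, Set.mem_iInter]
  intro N hN
  refine mem_closure_of_tendsto hlim ?_
  filter_upwards [eventually_ge_atTop N] with n hn
  exact Set.mem_iUnion₂.2 ⟨n, hn, hp n (hN.trans hn)⟩

omit [DecidableEq X] in
lemma iInter_regionAt_subset_limitRegion (δ : ℝ) :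
    (⋂ (n : ℕ) (_ : 1 ≤ n), C.regionAt δ n) ⊆ C.limitRegion δ := fun L hL =>
  ⟨fun _ => L, fun n hn => Set.mem_iInter₂.1 hL n hn, tendsto_const_nhds⟩

omit [DecidableEq X] in
lemma limitRegion_subset_iInter_regionAt (hac : C.AbsCont) {δ : ℝ}
    (hmono : ∀ n : ℕ, 1 ≤ n → C.regionAt δ (n + 1) ⊆ C.regionAt δ n) :
    C.limitRegion δ ⊆ ⋂ (n : ℕ) (_ : 1 ≤ n), C.regionAt δ n := by
  rintro L ⟨p, hp, hlim⟩
  refine Set.mem_iInter₂.2 fun n hn => (isClosed_regionAt hac δ n).mem_of_tendsto hlim ?_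
  filter_upwards [eventually_ge_atTop n] with m hm
  have hsub : C.regionAt δ m ⊆ C.regionAt δ n := by
    induction m, hm using Nat.le_induction with
    | base => exact le_rfl
    | succ k hk ih => exact (hmono k (hn.trans hk)).trans ih
  exact hsub (hp m (hn.trans hm))

end CovertBC

/-! ### The rate region equals the single-letter region. -/

namespace CovertBC

open CovertInfo

section SingleLetter

lemma sum_smul_support_equiv {ι κ E : Type*} [Fintype ι] [Fintype κ] [AddCommGroup E] [Module ℝ E]
    (w : ι → ℝ) (e : κ ≃ {i // w i ≠ 0}) (F : ι → E) :
    ∑ k, w (e k) • F (e k) = ∑ i, w i • F i := by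
  classical
  rw [e.sum_comp fun i => w i • F i]
  refine Fintype.sum_of_injective Subtype.val Subtype.val_injective _ _ (fun i hi => ?_)
    fun i => rfl
  rw [show w i = 0 from by_contra fun h => hi ⟨⟨i, h⟩, rfl⟩, zero_smul]

variable {X Y₁ Y₂ Z : Type*} [Fintype X] [Fintype Y₁] [Fintype Y₂] [Fintype Z]

/-- The point of the single-letter region's data: the mixture of a direction `PA` near `x₀` and of
a joint distribution `PB`. -/
noncomputable def splitPoint {υ : Type*} [Fintype υ] (C : CovertBC X Y₁ Y₂ Z) (ν : ℝ)
    (PA : X → ℝ) (PB : υ × X → ℝ) : (X → ℝ) × ℝ × ℝ :=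
  (1 - ν) • (PA, avgDiv C.W₁ C.x₀ PA, 0) + ν • ∑ u, C.infoPoint (fun x => PB (u, x))

variable {C : CovertBC X Y₁ Y₂ Z}

lemma avgDiv_sum {α β ι : Type*} [Fintype α] [Fintype β] (W : α → β → ℝ) (x₀ : α)
    (s : Finset ι) (f : ι → α → ℝ) :
    avgDiv W x₀ (∑ i ∈ s, f i) = ∑ i ∈ s, avgDiv W x₀ (f i) := by
  simp only [avgDiv, Finset.sum_apply, Finset.sum_mul]
  exact Finset.sum_comm

/-- By `infoXYgivenU_eq`, the bracket for user 2 collapses to ν times the sum of `outDiv` over the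
slices of `PB`, the third coordinate of the split point. -/
lemma mem_singleLetterRegion_iff (hac : C.AbsCont) {L : ℝ × ℝ} :
    L ∈ C.singleLetterRegion ↔ 0 ≤ L ∧ ∃ (ν : ℝ) (k : ℕ) (u₀ : Fin k)
      (PB : {u : Fin k // u ≠ u₀} × X → ℝ) (PA : X → ℝ), ν ∈ Set.Icc (0 : ℝ) 1 ∧
      k ≤ Fintype.card X + 1 ∧ PB ∈ stdSimplex ℝ ({u : Fin k // u ≠ u₀} × X) ∧
      PA ∈ puncturedSimplex C.x₀ ∧ 0 < C.cost (C.splitPoint ν PA PB).1 ∧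
      L ≤ √(2 / C.cost (C.splitPoint ν PA PB).1) • (C.splitPoint ν PA PB).2 := by
  have h1 : ∀ (ν : ℝ) (k : ℕ) (u₀ : Fin k) (PB : {u : Fin k // u ≠ u₀} × X → ℝ) (PA : X → ℝ),
      C.cost (C.splitPoint ν PA PB).1 = chiSq (fun z => (1 - ν) * output PA C.WZ z
          + ν * output (marginalX PB) C.WZ z) (C.WZ C.x₀) := fun ν k u₀ PB PA => by
    rw [cost, splitPoint, Prod.fst_add, Prod.smul_fst, Prod.smul_fst, sum_infoPoint_fst,
      output_add, output_smul, output_smul]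
    rfl
  have h2 : ∀ (ν : ℝ) (k : ℕ) (u₀ : Fin k) (PB : {u : Fin k // u ≠ u₀} × X → ℝ) (PA : X → ℝ),
      PB ∈ stdSimplex ℝ ({u : Fin k // u ≠ u₀} × X) →
      (C.splitPoint ν PA PB).2 =
        ((1 - ν) * (∑ x, PA x * divergence (C.W₁ x) (C.W₁ C.x₀)) + ν * infoXYgivenU PB C.W₁,
          ν * (∑ x, marginalX PB x * divergence (C.W₂ x) (C.W₂ C.x₀))
          - ν * infoXYgivenU PB C.W₂) := fun ν k u₀ PB PA hPB => by
    have hm : marginalX PB = ∑ u, fun x => PB (u, x) := by funext x; simp [marginalX]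
    refine Prod.ext ?_ ?_
    · rw [← sum_infoPoint_snd_fst hac hPB.1]
      rfl
    · change (1 - ν) * 0 + ν * (∑ u, C.infoPoint (fun x => PB (u, x))).2.2 =
        ν * avgDiv C.W₂ C.x₀ (marginalX PB) - ν * infoXYgivenU PB C.W₂
      rw [sum_infoPoint_snd_snd, hac.dominated₂.infoXYgivenU_eq hPB.1, hm, avgDiv_sum,
        Finset.sum_sub_distrib]
      ring
  constructor
  · rintro ⟨l1, l2, ν, k, u₀, PB, PA, hν, hk, hPB, hPA, hPA0, χ, hχ, hpos, b1, b2⟩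
    rw [← h1] at hχ
    subst hχ
    refine ⟨⟨l1, l2⟩, ν, k, u₀, PB, PA, hν, hk, hPB, ⟨hPA, hPA0⟩, hpos, ?_⟩
    rw [h2 _ _ _ _ _ hPB]
    exact ⟨b1, b2⟩
  · rintro ⟨l, ν, k, u₀, PB, PA, hν, hk, hPB, ⟨hPA, hPA0⟩, hpos, b⟩
    refine ⟨l.1, l.2, ν, k, u₀, PB, PA, hν, hk, hPB, hPA, hPA0, _, h1 .., hpos, ?_⟩
    rw [h2 _ _ _ _ _ hPB] at b
    exact ⟨b.1, b.2⟩

lemma exists_eq_sum_smul_punctured [Nontrivial X] {x₀ : X} {f : X → ℝ} (hf : ∀ x, 0 ≤ f x)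
    (hf0 : f x₀ = 0) : ∃ q ∈ puncturedSimplex x₀, f = (∑ x, f x) • q := by
  obtain ⟨q, hq, he⟩ := exists_eq_sum_smul hf
  rcases eq_or_ne (∑ x, f x) 0 with h | h
  · obtain ⟨q', hq'⟩ := puncturedSimplex_nonempty x₀
    rw [h, zero_smul] at he
    exact ⟨q', hq', by rw [h, he, zero_smul]⟩
  · refine ⟨q, ⟨hq, ?_⟩, he⟩
    have := congrFun he x₀
    rw [hf0, Pi.smul_apply, smul_eq_mul] at this
    exact (mul_eq_zero.1 this.symm).resolve_left h

variable [DecidableEq X]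

lemma cost_mix (μ : ℝ) (p : X → ℝ) : C.cost (mix C.x₀ μ p) = μ ^ 2 * C.cost p :=
  chiSq_mix _ _ _ _

/-- The cost is quadratic and the rates are linear in the mass, so mass at x₀ has no effect on
normalized rates. -/
lemma sqrt_cost_mix_smul {μ : ℝ} (hμ : 0 < μ) (v : (X → ℝ) × ℝ × ℝ) :
    √(2 / C.cost (mix C.x₀ μ v.1)) • μ • v.2 = √(2 / C.cost v.1) • v.2 := by
  rw [cost_mix, smul_smul, mul_comm (μ ^ 2), ← div_div, Real.sqrt_div' _ (sq_nonneg μ),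
    Real.sqrt_sq hμ.le, div_mul_cancel₀ _ hμ.ne']

lemma ratePoint_zero (p : X → ℝ) : C.ratePoint (0, p) = (p, avgDiv C.W₁ C.x₀ p, 0) := by
  simp [ratePoint, outDivRate]

/-- The A part is a rate point at μ = 0 and the B part lies in `infoHull`, so the split point is a
positive mass times a point of `rateHull`; positivity comes from χ₂(ν) > 0. -/
lemma singleLetterRegion_subset_rateRegion [Nontrivial X] (hac : C.AbsCont) :
    C.singleLetterRegion ⊆ C.rateRegion := by
  intro L hL
  obtain ⟨h0, ν, k, u₀, PB, PA, hν, -, hPB, hPA, hpos, hL⟩ := (mem_singleLetterRegion_iff hac).1 hL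
  have hA : (PA, avgDiv C.W₁ C.x₀ PA, 0) ∈ C.rateHull := by
    rw [← ratePoint_zero]
    exact subset_convexHull ℝ _ ⟨(0, PA), ⟨by simp, hPA⟩, rfl⟩
  have hQ : C.splitPoint ν PA PB ∈ convexHull ℝ (insert (Pi.single C.x₀ 1, 0) C.rateHull) :=
    convex_convexHull ℝ _ (subset_convexHull ℝ _ (Set.mem_insert_of_mem _ hA))
      (infoHull_subset hac (sum_infoPoint_mem hac hPB)) (by linarith [hν.2]) hν.1 (by ring)
  obtain ⟨μ, hμ, v, hv, he⟩ := exists_rate_decomposition hQ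
  rw [he] at hpos hL
  have hμ0 : 0 < μ := by
    refine hμ.1.lt_of_ne fun h => ?_
    simp [← h, cost_mix] at hpos
  rw [sqrt_cost_mix_smul hμ0] at hL
  exact ⟨h0, v, hv, hL⟩

/-- A point of the hull of rate points is dominated by a combination of at most `|X|` of them with
the same direction. -/
lemma exists_short_combination {v : (X → ℝ) × ℝ × ℝ} (hv : v ∈ C.rateHull) :
    ∃ N ≤ Fintype.card X, ∃ (w a : Fin N → ℝ) (p : Fin N → X → ℝ), (∀ i, 0 ≤ w i) ∧
      ∑ i, w i = 1 ∧ (∀ i, a i ∈ Set.Icc 0 1) ∧ (∀ i, p i ∈ puncturedSimplex C.x₀) ∧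
      (∑ i, w i • C.ratePoint (a i, p i)).1 = v.1 ∧
      v.2 ≤ (∑ i, w i • C.ratePoint (a i, p i)).2 := by
  obtain ⟨ι, _, w, z, hw, hw1, hz, rfl⟩ := mem_convexHull_iff_exists_fintype.1 hv
  choose g hg hgz using hz
  obtain rfl : (fun i => C.ratePoint (g i)) = z := funext hgz
  have hfin : Module.finrank ℝ (({x : X // x ≠ C.x₀} → ℝ) × ℝ) = Fintype.card X := by
    have hpos : 0 < Fintype.card X := Fintype.card_pos_iff.2 ⟨C.x₀⟩
    simp only [Module.finrank_prod, Module.finrank_fintype_fun_eq_card, Module.finrank_self,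
      Fintype.card_subtype_compl, Fintype.card_subtype_eq]
    omega
  -- The direction (|X| - 1 coordinates) and the Y₂ rate are preserved, in dimension |X|; the Y₁
  -- rate is the objective. Directions sum to one, which supplies the hyperplane.
  let f : ι → ({x : X // x ≠ C.x₀} → ℝ) × ℝ := fun i => (fun x => (g i).2 x, (C.ratePoint (g i)).2.2)
  let ℓ : ({x : X // x ≠ C.x₀} → ℝ) × ℝ →ₗ[ℝ] ℝ :=
    (∑ x, LinearMap.proj x) ∘ₗ LinearMap.fst ℝ _ ℝ
  have hℓ : ∀ i, ℓ (f i) = 1 := fun i => by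
    have h0 : (g i).2 C.x₀ = 0 := (hg i).2.2
    have h1 := Fintype.sum_subtype_add_sum_subtype (fun x => x ≠ C.x₀) (g i).2
    have h2 : ∑ x : {x // ¬ x ≠ C.x₀}, (g i).2 x = 0 := Finset.sum_eq_zero fun x _ => by
      rw [not_not.1 x.2, h0]
    rw [h2, add_zero, (hg i).2.1.2] at h1
    simpa [ℓ, f] using h1
  obtain ⟨w', hw', hcard, hf, hs⟩ :=
    exists_nonneg_weights_card_support_le f ℓ hℓ (fun i => (C.ratePoint (g i)).2.1) w hw
  have hw'1 : ∑ i, w' i = 1 := by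
    have := congrArg ℓ hf
    simpa [hℓ, hw1] using this
  have hfst : (∑ i, w' i • C.ratePoint (g i)).1 = (∑ i, w i • C.ratePoint (g i)).1 := by
    funext x
    rcases eq_or_ne x C.x₀ with rfl | hx
    · have h0 : ∀ i, (g i).2 C.x₀ = 0 := fun i => (hg i).2.2
      simp [Prod.fst_sum, ratePoint, h0]
    · have := congrFun (congrArg Prod.fst hf) ⟨x, hx⟩
      simpa [Prod.fst_sum, f, ratePoint] using this
  have hsnd : (∑ i, w i • C.ratePoint (g i)).2 ≤ (∑ i, w' i • C.ratePoint (g i)).2 := by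
    constructor
    · simpa [Prod.snd_sum, Prod.fst_sum] using hs
    · have := congrArg Prod.snd hf
      simp only [f, Prod.snd_sum, Prod.smul_snd] at this ⊢
      exact this.ge
  set e : Fin (Nat.card {i // w' i ≠ 0}) ≃ {i // w' i ≠ 0} := (Finite.equivFin _).symm
  refine ⟨_, hcard.trans_eq hfin, fun i => w' (e i), fun i => (g (e i)).1, fun i => (g (e i)).2,
    fun i => hw' _, ?_, fun i => (hg _).1, fun i => (hg _).2, ?_, ?_⟩
  · simpa [hw'1] using sum_smul_support_equiv w' e fun _ => (1 : ℝ)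
  · rw [← hfst]
    exact congrArg Prod.fst (sum_smul_support_equiv w' e fun i => C.ratePoint (g i))
  · refine hsnd.trans_eq ?_
    exact congrArg Prod.snd (sum_smul_support_equiv w' e fun i => C.ratePoint (g i)).symm

/-- A convex combination of rate points, moved towards the zero input, is the point of a mixture
of a direction near `x₀` and of a joint distribution with one letter for each rate point. -/
lemma exists_splitPoint_eq [Nontrivial X] (hac : C.AbsCont) {υ : Type*} [Fintype υ]
    {w a : υ → ℝ} {p : υ → X → ℝ} (hw : ∀ i, 0 ≤ w i) (hw1 : ∑ i, w i = 1)
    (ha : ∀ i, a i ∈ Set.Icc 0 1) (hp : ∀ i, p i ∈ puncturedSimplex C.x₀) :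
    ∃ ν ∈ Set.Icc (0 : ℝ) 1, ∃ PA ∈ puncturedSimplex C.x₀, ∃ PB ∈ stdSimplex ℝ (υ × X),
      ∃ μ : ℝ, 0 < μ ∧ C.splitPoint ν PA PB = (1 - μ) • (Pi.single C.x₀ 1, 0) +
        μ • ∑ i, w i • C.ratePoint (a i, p i) := by
  have : Nonempty υ := by
    by_contra h
    rw [not_nonempty_iff] at h
    simp at hw1
  have : Nonempty X := ⟨C.x₀⟩
  -- Terms with a = 0 go to A with weight w. The others go to B with weight w/a, so that mass w lies
  -- away from x₀; for a = 0 the quotient w/a is 0 by convention.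
  let c : υ → ℝ := fun i => if a i = 0 then w i else 0
  have hc : ∀ i, 0 ≤ c i := fun i => by
    simp only [c]; split_ifs <;> simp [hw]
  have hwa : ∀ i, 0 ≤ w i / a i := fun i => div_nonneg (hw i) (ha i).1
  have hwc : ∀ i, w i ≤ c i + w i / a i := fun i => by
    by_cases h : a i = 0
    · simp [c, h]
    · simp only [c, if_neg h, zero_add]
      exact le_div_self (hw i) ((ha i).1.lt_of_ne' h) (ha i).2
  let fA : X → ℝ := ∑ i, c i • p i
  let fB : υ × X → ℝ := fun j => w j.1 / a j.1 * mix C.x₀ (a j.1) (p j.1) j.2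
  have hfA0 : fA C.x₀ = 0 := by
    have h0 : ∀ i, p i C.x₀ = 0 := fun i => (hp i).2
    simp [fA, h0]
  have hfA : ∀ x, 0 ≤ fA x := fun x => by
    simp only [fA, Finset.sum_apply]
    exact Finset.sum_nonneg fun i _ => mul_nonneg (hc i) ((hp i).1.1 x)
  have hfB : ∀ j, 0 ≤ fB j := fun j =>
    mul_nonneg (hwa _) ((mix_mem C.x₀ (ha _).1 (ha _).2 (hp _).1).1 _)
  obtain ⟨PA, hPA, eA⟩ := exists_eq_sum_smul_punctured hfA hfA0
  obtain ⟨PB, hPB, eB⟩ := exists_eq_sum_smul hfB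
  have sA : ∑ x, fA x = ∑ i, c i := by
    simp only [fA, Finset.sum_apply]
    rw [Finset.sum_comm]
    simp [← Finset.mul_sum, (hp _).1.2]
  have sB : ∑ j, fB j = ∑ i, w i / a i := by
    rw [Fintype.sum_prod_type]
    simp only [fB, ← Finset.mul_sum, sum_mix C.x₀ _ (hp _).1.2, mul_one]
  rw [sA] at eA
  rw [sB] at eB
  set τA := ∑ i, c i
  set τB := ∑ i, w i / a i
  have hA0 : 0 ≤ τA := Finset.sum_nonneg fun i _ => hc i
  have hB0 : 0 ≤ τB := Finset.sum_nonneg fun i _ => hwa i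
  have hτ : 0 < τA + τB := by
    refine zero_lt_one.trans_le ?_
    rw [← hw1, ← Finset.sum_add_distrib]
    exact Finset.sum_le_sum fun i _ => hwc i
  -- The total weight τA + τB is at least 1, and its excess over 1 sits at the base point. Dividing
  -- by τA + τB yields ν and μ.
  have key : (fA, avgDiv C.W₁ C.x₀ fA, (0 : ℝ)) + ∑ i, C.infoPoint (fun x => fB (i, x)) =
      (τA + τB - 1) • (Pi.single C.x₀ 1, 0) + ∑ i, w i • C.ratePoint (a i, p i) := by
    have e1 : (fA, avgDiv C.W₁ C.x₀ fA, (0 : ℝ)) = ∑ i, c i • C.ratePoint (0, p i) := by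
      simp only [ratePoint_zero]
      refine Prod.ext ?_ (Prod.ext ?_ ?_)
      · simp [fA, Prod.fst_sum]
      · simp [fA, Prod.fst_sum, Prod.snd_sum, avgDiv_sum, avgDiv_smul]
      · simp [Prod.snd_sum]
    have e2 : ∀ i, C.infoPoint (fun x => fB (i, x)) =
        (w i / a i) • C.infoPoint (mix C.x₀ (a i) (p i)) := fun i => by
      rw [← infoPoint_smul hac]
      rfl
    have e3 : τA + τB - 1 = ∑ i, (c i + w i / a i - w i) := by
      rw [Finset.sum_sub_distrib, Finset.sum_add_distrib, hw1]
    rw [e1, e3, ← Finset.sum_add_distrib, Finset.sum_smul,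
      ← Finset.sum_add_distrib]
    refine Finset.sum_congr rfl fun i _ => ?_
    rw [e2, infoPoint_mix hac]
    by_cases h : a i = 0
    · simp [c, h]
    · simp only [c, if_neg h, zero_smul, zero_add, smul_add, smul_smul, div_mul_cancel₀ _ h]
      congr 2
      field_simp
  have hB : ∀ i, C.infoPoint (fun x => fB (i, x)) = τB • C.infoPoint (fun x => PB (i, x)) :=
    fun i => by
      rw [← infoPoint_smul hac, eB]
      rfl
  have hA : (fA, avgDiv C.W₁ C.x₀ fA, (0 : ℝ)) = τA • (PA, avgDiv C.W₁ C.x₀ PA, (0 : ℝ)) := by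
    rw [eA, avgDiv_smul]
    simp
  simp only [hA, hB, ← Finset.smul_sum] at key
  refine ⟨τB / (τA + τB), ⟨by positivity, by rw [div_le_one₀ hτ]; linarith⟩, PA, hPA, PB, hPB,
    (τA + τB)⁻¹, by positivity, ?_⟩
  have e3 : 1 - τB / (τA + τB) = (τA + τB)⁻¹ * τA := by field_simp; ring
  have e4 : τB / (τA + τB) = (τA + τB)⁻¹ * τB := by field_simp
  have e5 : 1 - (τA + τB)⁻¹ = (τA + τB)⁻¹ * (τA + τB - 1) := by field_simp
  rw [splitPoint, e3, e4, e5, mul_smul, mul_smul, mul_smul, ← smul_add, ← smul_add, key]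

lemma rateRegion_subset_singleLetterRegion [Nontrivial X] (hred : C.NonRedundant)
    (hac : C.AbsCont) : C.rateRegion ⊆ C.singleLetterRegion := by
  rintro L ⟨h0, v, hv, hL⟩
  obtain ⟨N, hN, w, a, p, hw, hw1, ha, hp, h1, h2⟩ := exists_short_combination hv
  -- Letter 0 serves as u₀ and the N ≤ |X| rate points index B, whence at most |X| + 1 letters.
  let e : Fin N ≃ {u : Fin (N + 1) // u ≠ 0} := finSuccAboveEquiv 0
  obtain ⟨ν, hν, PA, hPA, PB, hPB, μ, hμ, hsplit⟩ := exists_splitPoint_eq hac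
    (w := w ∘ e.symm) (a := a ∘ e.symm) (p := p ∘ e.symm) (fun i => hw _)
    ((e.symm.sum_comp w).trans hw1) (fun i => ha _) (fun i => hp _)
  have hsum : ∑ i, (w ∘ e.symm) i • C.ratePoint ((a ∘ e.symm) i, (p ∘ e.symm) i) =
      ∑ i, w i • C.ratePoint (a i, p i) :=
    e.symm.sum_comp fun i => w i • C.ratePoint (a i, p i)
  rw [hsum] at hsplit
  set v' := ∑ i, w i • C.ratePoint (a i, p i)
  have hs : C.splitPoint ν PA PB = (mix C.x₀ μ v'.1, μ • v'.2) := by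
    rw [hsplit]
    refine Prod.ext ?_ ?_ <;> simp [mix]
  have hv'1 : v'.1 ∈ puncturedSimplex C.x₀ := by
    have hsub : C.rateHull ⊆ puncturedSimplex C.x₀ ×ˢ Set.univ := by
      refine convexHull_min ?_ ((convex_puncturedSimplex _).prod convex_univ)
      rintro _ ⟨q, hq, rfl⟩
      exact ⟨hq.2, trivial⟩
    rw [h1]
    exact (hsub hv).1
  refine (mem_singleLetterRegion_iff hac).2 ⟨h0, ν, N + 1, 0, PB, PA, hν, by omega, hPB, hPA,
    ?_, ?_⟩
  · rw [hs, cost_mix]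
    exact mul_pos (by positivity) (cost_pos hred hac hv'1)
  · rw [hs, sqrt_cost_mix_smul hμ, h1]
    exact hL.trans (smul_le_smul_of_nonneg_left h2 (Real.sqrt_nonneg _))

end SingleLetter

end CovertBC

theorem theorem2 {X Y₁ Y₂ Z : Type*} [Fintype X] [Fintype Y₁] [Fintype Y₂] [Fintype Z]
    [Nontrivial X] (C : CovertBC X Y₁ Y₂ Z)
    (hred : C.NonRedundant) (hac : C.AbsCont) (hdeg : C.Degraded)
    (δ : ℝ) (hδ : 0 < δ) :
    C.limitRegion δ = C.singleLetterRegion ∧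
    C.outerLimitRegion δ = C.singleLetterRegion ∧
    (⋂ (n : ℕ) (_ : 1 ≤ n), C.regionAt δ n) ⊆ C.singleLetterRegion ∧
    ((∀ n : ℕ, 1 ≤ n → C.regionAt δ (n + 1) ⊆ C.regionAt δ n) →
      (⋂ (n : ℕ) (_ : 1 ≤ n), C.regionAt δ n) = C.singleLetterRegion) := by
  classical
  have hs : C.singleLetterRegion = C.rateRegion :=
    (CovertBC.singleLetterRegion_subset_rateRegion hac).antisymm
      (CovertBC.rateRegion_subset_singleLetterRegion hred hac)
  have h1 := CovertBC.rateRegion_subset_limitRegion hred hac hδ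
  have h2 := CovertBC.limitRegion_subset_outerLimitRegion (C := C) δ
  have h3 := CovertBC.outerLimitRegion_subset hred hac hδ
  have h4 := CovertBC.iInter_regionAt_subset_limitRegion (C := C) δ
  -- The inclusions `rateRegion` ⊆ inner limit ⊆ outer limit ⊆ `rateRegion` close up.
  have hlim : C.limitRegion δ = C.rateRegion := (h2.trans h3).antisymm h1
  rw [hs]
  refine ⟨hlim, h3.antisymm (h1.trans h2), h4.trans hlim.subset, fun hmono => ?_⟩
  exact (h4.trans hlim.subset).antisymm
    (h1.trans (CovertBC.limitRegion_subset_iInter_regionAt hac hmono))
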